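/- Let $n\ge 2$ and let $\Sigma=\{\pm(e_i+e_j),\pm(e_i-e_j),\pm 2e_i \mid i\ne j\}\subset\mathbb{R}^n$ be the root system of type $C_n$, with simple roots $\Theta=\{\alpha_1,\dots,\alpha_n\}$, $\alpha_i=e_i-e_{i+1}$ for $i<n$ and $\alpha_n=2e_n$, positive roots $\Sigma^+$, and Weyl group $W$ generated by the simple reflections, equipped with its length function and Bruhat order $\le$. Let $\Theta_P,\Theta_Q\subseteq\Theta$, and let $W_P,W_Q\subseteq W$ be the subgroups generated by the corresponding simple reflections. Let $W^P$ and ${}^QW^P$ be the sets of minimal length representatives of $W/W_P$ and $W_Q\backslash W/W_P$, and for $w\in W$ let $\overline{w}\in W^P$ and $\widehat{w}\in{}^QW^P$ be the minimal length representatives of $wW_P$ and $W_QwW_P$. The parabolic moment graph $\mathcal{G}^P$ has vertex set $W^P$ and an edge $w\to\overline{s_\alpha w}$ labelled by $\alpha$ for all $w\in W^P$, $\alpha\in\Sigma^+$ with $w\le s_\alpha w$ and $\overline{w}\ne\overline{s_\alpha w}$. A double moment graph ${}^Q\mathcal{G}^P$ has vertex set ${}^QW^P$ and an edge $u\to u'$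 whenever $u\ne u'$ and there is $\beta\in\Sigma^+$ with $u\le s_\beta u$ and $u'=\widehat{s_\beta u}$; each edge $u\to u'$ is labelled by one chosen root $l(u\to u')$ among these $\beta$. It is viewed as a subgraph $\mathcal{G}'$ of $\mathcal{G}^P$ whose vertices are the elements of ${}^QW^P$ and the elements $\overline{s_{l(u\to u')}u}$, and whose edges are $u\to\overline{s_{l(u\to u')}u}$ with label $l(u\to u')$, for all edges $u\to u'$ of ${}^Q\mathcal{G}^P$. Let $W_Q$ act on $W^P$ by $w(x)=\overline{wx}$. The closure of ${}^Q\mathcal{G}^P$ is the subgraph of $\mathcal{G}^P$ whose vertices are the $w(x)$ with $w\in W_Q$ and $x$ a vertex of $\mathcal{G}'$, and whose edges are: all edges of $\mathcal{G}^P$ of the form $w(x)\to v(x)$ with $w,v\in W_Q$ and $x$ a vertex of $\mathcal{G}'$; and, for every edge $x\to y$ of $\mathcal{G}'$ with label $\alpha$ and every $w\in W_Q$, the edge $w(x)\to w(y)$ with label $w(\alpha)$ if $w(\alpha)\in\Sigma^+$, and the edge $w(y)\to w(x)$ with label $-w(\alpha)$ if $-w(\alpha)\in\Sigma^+$. The double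 moment graph ${}^Q\mathcal{G}^P$ is called closed if its closure equals $\mathcal{G}^P$. Proposition. For every choice of labels, the double moment graph ${}^Q\mathcal{G}^P$ is closed if and only if at least one of the following holds: - there exist $p,q$ with $1\le p,q\le n$ such that $\Theta_P=\{\alpha_p,\dots,\alpha_n\}$ and $\Theta_Q=\{\alpha_q,\dots,\alpha_n\}$; - $\alpha_n\notin\Theta_P$ and $\alpha_n\notin\Theta_Q$; - $\Theta_P=\Theta$ or $\Theta_Q=\Theta$; - $\Theta_P=\emptyset$ or $\Theta_Q=\emptyset$. -/

import Mathlib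

noncomputable section

namespace TypeC

/-! ### The root system of type `C_n` and its Weyl group

Simple roots are indexed from `0`: the index `i : Fin n` stands for the `(i + 1)`-st simple root.
Subsets of the set of simple roots are given as sets of indices. -/

/-- The ambient Euclidean space `ℝⁿ`. -/
abbrev Space (n : ℕ) : Type := EuclideanSpace ℝ (Fin n)

/-- Linear isometries of the ambient space; the Weyl group is a subgroup of this group. -/
abbrev Isom (n : ℕ) : Type := Space n ≃ₗᵢ[ℝ] Space n

/-- The standard basis vector `e_i`. -/
def e {n : ℕ} (i : Fin n) : Space n := EuclideanSpace.single i (1 : ℝ)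

/-- The roots of type `C_n`: `±(e_i + e_j)`, `±(e_i - e_j)` for `i ≠ j`, and `±2 e_i`. -/
def roots (n : ℕ) : Set (Space n) :=
  {α | (∃ i j : Fin n, i ≠ j ∧
          (α = e i + e j ∨ α = -(e i + e j) ∨ α = e i - e j ∨ α = -(e i - e j))) ∨
       ∃ i : Fin n, α = (2 : ℝ) • e i ∨ α = -((2 : ℝ) • e i)}

/-- The simple roots `e_1 - e_2, …, e_{n-1} - e_n, 2 e_n`. -/
def simpleRoot {n : ℕ} (i : Fin n) : Space n :=
  if h : (i : ℕ) + 1 < n then e i - e ⟨(i : ℕ) + 1, h⟩ else (2 : ℝ) • e i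

/-- The positive roots: the roots that are nonnegative integral combinations of simple roots. -/
def posRoots (n : ℕ) : Set (Space n) :=
  {α | α ∈ roots n ∧ ∃ c : Fin n → ℕ, α = ∑ i, (c i : ℝ) • simpleRoot i}

/-- The reflection `s_α` in the hyperplane orthogonal to `α`. -/
def refl {n : ℕ} (α : Space n) : Isom n := (Submodule.span ℝ {α})ᗮ.reflection

/-- The subgroup `W_J` generated by the simple reflections with index in `J`. -/
def parabolic {n : ℕ} (J : Set (Fin n)) : Subgroup (Isom n) :=
  Subgroup.closure ((fun i => refl (simpleRoot i)) '' J)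

/-- The Weyl group `W`. -/
def weyl (n : ℕ) : Subgroup (Isom n) := parabolic Set.univ

/-- The length of `w ∈ W`: the least length of a word in the simple reflections
with product `w`. -/
def length {n : ℕ} (w : Isom n) : ℕ :=
  sInf {k | ∃ l : List (Fin n), l.length = k ∧ (l.map fun i => refl (simpleRoot i)).prod = w}

/-- The Bruhat order `≤` on `W`: the reflexive transitive closure of the relations
`x < s_α x` for roots `α` with `ℓ(x) < ℓ(s_α x)`. -/
def BruhatLE {n : ℕ} : Isom n → Isom n → Prop :=
  Relation.ReflTransGen fun x y =>
    x ∈ weyl n ∧ ∃ α ∈ roots n, y = refl α * x ∧ length x < length y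

/-! ### Minimal coset representatives -/

/-- The left coset `w W_P`. -/
def leftCoset {n : ℕ} (P : Set (Fin n)) (w : Isom n) : Set (Isom n) :=
  {x | ∃ b ∈ parabolic P, x = w * b}

/-- The double coset `W_Q w W_P`. -/
def doubleCoset {n : ℕ} (Q P : Set (Fin n)) (w : Isom n) : Set (Isom n) :=
  {x | ∃ a ∈ parabolic Q, ∃ b ∈ parabolic P, x = a * w * b}

/-- The set `W^P` of minimal length representatives of the cosets in `W / W_P`. -/
def minLeft {n : ℕ} (P : Set (Fin n)) : Set (Isom n) :=
  {w | w ∈ weyl n ∧ ∀ x ∈ leftCoset P w, length w ≤ length x}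

/-- The set `^Q W^P` of minimal length representatives of the double cosets in
`W_Q \ W / W_P`. -/
def minDouble {n : ℕ} (Q P : Set (Fin n)) : Set (Isom n) :=
  {w | w ∈ weyl n ∧ ∀ x ∈ doubleCoset Q P w, length w ≤ length x}

theorem leftCoset_nonempty {n : ℕ} (P : Set (Fin n)) (w : Isom n) :
    (leftCoset P w).Nonempty :=
  ⟨w, 1, one_mem _, by simp⟩

theorem doubleCoset_nonempty {n : ℕ} (Q P : Set (Fin n)) (w : Isom n) :
    (doubleCoset Q P w).Nonempty :=
  ⟨w, 1, one_mem _, 1, one_mem _, by simp⟩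

/-- The element of minimal length in `w W_P`, usually written `w` with a bar. -/
def bar {n : ℕ} (P : Set (Fin n)) (w : Isom n) : Isom n :=
  Function.argminOn length (leftCoset P w) (leftCoset_nonempty P w)

/-- The element of minimal length in `W_Q w W_P`, usually written `w` with a hat. -/
def hat {n : ℕ} (Q P : Set (Fin n)) (w : Isom n) : Isom n :=
  Function.argminOn length (doubleCoset Q P w) (doubleCoset_nonempty Q P w)

/-! ### Moment graphs -/

/-- The underlying data of a moment graph whose vertices lie in `W`: a set of vertices and a set
of directed labelled edges, where `(x, α, y)` is the edge `x → y` with label `α`.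
The vertices are partially ordered by the Bruhat order. -/
@[ext]
structure MomentGraph (n : ℕ) where
  verts : Set (Isom n)
  edges : Set (Isom n × Space n × Isom n)

/-- The parabolic moment graph `G^P`. -/
def parabolicGraph {n : ℕ} (P : Set (Fin n)) : MomentGraph n where
  verts := minLeft P
  edges := {t | ∃ w ∈ minLeft P, ∃ α ∈ posRoots n,
    BruhatLE w (refl α * w) ∧ bar P w ≠ bar P (refl α * w) ∧ t = (w, α, bar P (refl α * w))}

/-- `β` is one of the possible labels of the edge `u → u'` on `^Q W^P`. -/
def IsPossibleLabel {n : ℕ} (Q P : Set (Fin n)) (u u' : Isom n) (β : Space n) : Prop :=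
  β ∈ posRoots n ∧ u' = hat Q P (refl β * u) ∧ BruhatLE u (refl β * u)

/-- The edges `u → u'` of a double moment graph. -/
def doubleEdges {n : ℕ} (Q P : Set (Fin n)) : Set (Isom n × Isom n) :=
  {t | t.1 ∈ minDouble Q P ∧ t.1 ≠ t.2 ∧ ∃ β, IsPossibleLabel Q P t.1 t.2 β}

/-- A `(P, Q)`-double moment graph: its vertices (the elements of `^Q W^P`) and its edges are
determined by `P` and `Q`, and it is given by choosing, for each edge, one of the possible
labels. -/
structure DoubleMomentGraph {n : ℕ} (Q P : Set (Fin n)) where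
  label : doubleEdges Q P → Space n
  isPossibleLabel_label :
    ∀ t : doubleEdges Q P, IsPossibleLabel Q P t.1.1 t.1.2 (label t)

/-- A double moment graph viewed as a subgraph of `G^P`: an edge `u → u'` with label `α` becomes
the edge from `u` to the minimal representative of `s_α u W_P`, with the same label. -/
def DoubleMomentGraph.toParabolic {n : ℕ} {Q P : Set (Fin n)} (D : DoubleMomentGraph Q P) :
    MomentGraph n where
  verts := minDouble Q P ∪ {x | ∃ t : doubleEdges Q P, x = bar P (refl (D.label t) * t.1.1)}
  edges := {s | ∃ t : doubleEdges Q P,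
    s = (t.1.1, D.label t, bar P (refl (D.label t) * t.1.1))}

/-- The `W_Q`-closure of a subgraph `Γ` of `G^P`, where `w ∈ W_Q` acts on `W^P` by sending `x`
to the minimal representative of `w x W_P`. -/
def closureGraph {n : ℕ} (Q P : Set (Fin n)) (Γ : MomentGraph n) : MomentGraph n where
  verts := {y | ∃ w ∈ parabolic Q, ∃ x ∈ Γ.verts, y = bar P (w * x)}
  edges :=
    {t | t ∈ (parabolicGraph P).edges ∧ ∃ x ∈ Γ.verts, ∃ w ∈ parabolic Q, ∃ v ∈ parabolic Q,
        t.1 = bar P (w * x) ∧ t.2.2 = bar P (v * x)} ∪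
    {t | ∃ x α y, (x, α, y) ∈ Γ.edges ∧ ∃ w ∈ parabolic Q, w α ∈ posRoots n ∧
        t = (bar P (w * x), w α, bar P (w * y))} ∪
    {t | ∃ x α y, (x, α, y) ∈ Γ.edges ∧ ∃ w ∈ parabolic Q, -(w α) ∈ posRoots n ∧
        t = (bar P (w * y), -(w α), bar P (w * x))}

/-- A double moment graph is closed if its closure is the whole parabolic moment graph `G^P`. -/
def DoubleMomentGraph.IsClosed {n : ℕ} {Q P : Set (Fin n)} (D : DoubleMomentGraph Q P) : Prop :=
  closureGraph Q P D.toParabolic = parabolicGraph P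

end TypeC

end

/-! The coset `w W_P` corresponds to the point `w λ_P` of the orbit of a dominant vector `λ_P` with
stabilizer `W_P`. In these terms an edge of `G^P` is a root pairing positively with `w λ_P`. The
edges whose root is orthogonal to `λ_Q` lie in the closure of every double moment graph, and the
graph is closed if and only if any two other edges that start at the same point and end in the same
`W_Q`-orbit are conjugate under the common stabilizer of `λ_Q` and `w λ_P`.

Whether this holds can be read off the multiset of coordinate pairs of `(λ_Q, w λ_P)` along the
vectors `±e_i`: a reflection changes only the pairs along the vectors it moves, and these determine
its root up to that stabilizer unless a short and a long root become linked. For suitable `w` this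
happens exactly when one of `λ_P`, `λ_Q` repeats a nonzero coordinate and the other one has both a
zero and a nonzero coordinate. -/

open scoped RealInnerProductSpace

noncomputable section

namespace TypeC

/-! ### Reflections -/

section Reflections

variable {n : ℕ}

theorem refl_apply (α v : Space n) : refl α v = v - (2 * ⟪α, v⟫ / ⟪α, α⟫) • α := by
  rw [refl, Submodule.reflection_orthogonal_apply, Submodule.reflection_singleton_apply,
    neg_sub, real_inner_self_eq_norm_sq, ← Nat.cast_smul_eq_nsmul ℝ, smul_smul, mul_div_assoc]
  simp

theorem refl_self (α : Space n) : refl α α = -α :=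
  Submodule.reflection_orthogonalComplement_singleton_eq_neg α

theorem refl_refl_apply (α v : Space n) : refl α (refl α v) = v :=
  Submodule.reflection_reflection _ v

theorem refl_mul_self (α : Space n) : refl α * refl α = 1 :=
  Submodule.reflection_mul_reflection _

theorem refl_inv (α : Space n) : (refl α)⁻¹ = refl α :=
  Submodule.reflection_inv

theorem refl_neg (α : Space n) : refl (-α) = refl α := by
  refine LinearIsometryEquiv.ext fun v => ?_
  simp only [refl_apply, inner_neg_left, inner_neg_right, neg_neg, mul_neg, neg_div, neg_smul,
    smul_neg]

theorem isom_mul_apply (g h : Isom n) (v : Space n) : (g * h) v = g (h v) := rfl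

theorem inv_apply_self (g : Isom n) (v : Space n) : g⁻¹ (g v) = v := g.symm_apply_apply v

theorem apply_inv_self (g : Isom n) (v : Space n) : g (g⁻¹ v) = v := g.apply_symm_apply v

theorem inv_apply_eq {g : Isom n} {v w : Space n} : g⁻¹ v = w ↔ v = g w :=
  g.toEquiv.symm_apply_eq

theorem inner_map_left (g : Isom n) (v w : Space n) : ⟪g v, w⟫ = ⟪v, g⁻¹ w⟫ :=
  g.inner_map_eq_flip v w

theorem inner_map_right (g : Isom n) (v w : Space n) : ⟪v, g w⟫ = ⟪g⁻¹ v, w⟫ := by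
  rw [real_inner_comm, inner_map_left, real_inner_comm]

theorem inner_refl_left (α v w : Space n) : ⟪refl α v, w⟫ = ⟪v, refl α w⟫ := by
  rw [inner_map_left, refl_inv]

theorem inner_self_refl (α v : Space n) : ⟪α, refl α v⟫ = -⟪α, v⟫ := by
  rw [← inner_refl_left, refl_self, inner_neg_left]

theorem refl_eq_self_iff {α v : Space n} : refl α v = v ↔ ⟪α, v⟫ = 0 := by
  constructor
  · intro h
    have := inner_self_refl α v
    rw [h] at this
    linarith
  · intro h
    rw [refl_apply, h, mul_zero, zero_div, zero_smul, sub_zero]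

theorem map_refl (g : Isom n) (α v : Space n) : g (refl α v) = refl (g α) (g v) := by
  simp only [refl_apply, map_sub, map_smul, LinearIsometryEquiv.inner_map_map]

theorem mul_refl (g : Isom n) (α : Space n) : g * refl α = refl (g α) * g :=
  LinearIsometryEquiv.ext (map_refl g α)

theorem refl_map (g : Isom n) (α : Space n) : refl (g α) = g * refl α * g⁻¹ := by
  rw [mul_refl, mul_inv_cancel_right]

end Reflections

/-! ### Signed basis vectors -/

section SignedBasis

variable {n : ℕ}

theorem inner_e_left (i : Fin n) (v : Space n) : ⟪e i, v⟫ = v i := by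
  simp [e, EuclideanSpace.inner_single_left]

theorem inner_e_e (i j : Fin n) : ⟪(e i : Space n), e j⟫ = if i = j then 1 else 0 := by
  rw [inner_e_left]
  simp [e]

theorem e_injective : Function.Injective (e : Fin n → Space n) := by
  intro i j h
  by_contra hij
  have := congrArg (fun v => ⟪e i, v⟫) h
  simp only [inner_e_e, if_true, if_neg hij, one_ne_zero] at this

theorem e_ne_neg_e (i j : Fin n) : (e i : Space n) ≠ -e j := by
  intro h
  have := congrArg (fun v => ⟪e i, v⟫) h
  simp only [inner_neg_right, inner_e_e, if_true] at this
  split_ifs at this <;> norm_num at this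

/-- The vectors `±e_i`: the roots are the sums of two of them, and the Weyl group consists of the
isometries permuting them. -/
def signedBasis (n : ℕ) : Set (Space n) := {u | ∃ i, u = e i ∨ u = -e i}

theorem finite_signedBasis (n : ℕ) : (signedBasis n).Finite := by
  have h : signedBasis n = Set.range e ∪ Set.range fun i => -e i := by
    ext u
    simp only [signedBasis, Set.mem_ofPred_eq, Set.mem_union, Set.mem_range, ← exists_or,
      eq_comm (a := u)]
  rw [h]
  exact (Set.finite_range _).union (Set.finite_range _)

theorem e_mem_signedBasis (i : Fin n) : e i ∈ signedBasis n := ⟨i, Or.inl rfl⟩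

theorem neg_mem_signedBasis {u : Space n} (hu : u ∈ signedBasis n) : -u ∈ signedBasis n := by
  obtain ⟨i, rfl | rfl⟩ := hu
  · exact ⟨i, Or.inr rfl⟩
  · exact ⟨i, Or.inl (neg_neg _)⟩

theorem inner_self_signedBasis {u : Space n} (hu : u ∈ signedBasis n) : ⟪u, u⟫ = 1 := by
  obtain ⟨i, rfl | rfl⟩ := hu
  · simp only [inner_e_e, if_true]
  · simp only [inner_neg_neg, inner_e_e, if_true]

theorem ne_neg_self_of_mem_signedBasis {u : Space n} (hu : u ∈ signedBasis n) : u ≠ -u := by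
  intro h
  have := congrArg (fun v => ⟪u, v⟫) h
  simp only [inner_neg_right, inner_self_signedBasis hu] at this
  norm_num at this

theorem signedBasis_cases {u v : Space n} (hu : u ∈ signedBasis n) (hv : v ∈ signedBasis n) :
    u = v ∨ u = -v ∨ ⟪u, v⟫ = 0 := by
  obtain ⟨i, rfl | rfl⟩ := hu <;> obtain ⟨j, rfl | rfl⟩ := hv <;>
    by_cases h : i = j <;> simp [inner_e_e, h]

theorem exists_eq_add_of_mem_roots {α : Space n} (hα : α ∈ roots n) :
    ∃ u ∈ signedBasis n, ∃ v ∈ signedBasis n, u ≠ -v ∧ α = u + v := by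
  have neg_mem (i : Fin n) := neg_mem_signedBasis (e_mem_signedBasis i)
  rcases hα with ⟨i, j, hij, rfl | rfl | rfl | rfl⟩ | ⟨i, rfl | rfl⟩
  · exact ⟨e i, e_mem_signedBasis i, e j, e_mem_signedBasis j, e_ne_neg_e i j, rfl⟩
  · refine ⟨-e i, neg_mem i, -e j, neg_mem j, fun h => ?_, neg_add _ _⟩
    exact e_ne_neg_e i j (neg_injective h)
  · refine ⟨e i, e_mem_signedBasis i, -e j, neg_mem j, ?_, sub_eq_add_neg _ _⟩
    rw [neg_neg]
    exact e_injective.ne hij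
  · refine ⟨-e i, neg_mem i, e j, e_mem_signedBasis j, ?_, by abel⟩
    exact neg_injective.ne (e_injective.ne hij)
  · exact ⟨e i, e_mem_signedBasis i, e i, e_mem_signedBasis i, e_ne_neg_e i i, two_smul _ _⟩
  · refine ⟨-e i, neg_mem i, -e i, neg_mem i, fun h => ?_, by rw [two_smul, neg_add]⟩
    exact e_ne_neg_e i i (neg_injective h)

theorem add_mem_roots {u v : Space n} (hu : u ∈ signedBasis n) (hv : v ∈ signedBasis n)
    (huv : u ≠ -v) : u + v ∈ roots n := by
  obtain ⟨i, hu⟩ := hu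
  obtain ⟨j, hv⟩ := hv
  by_cases hij : i = j
  · subst hij
    refine Or.inr ⟨i, ?_⟩
    rcases hu with rfl | rfl <;> rcases hv with rfl | rfl
    · exact Or.inl (two_smul _ _).symm
    · exact absurd (neg_neg _).symm huv
    · exact absurd rfl huv
    · exact Or.inr (by rw [two_smul, neg_add])
  · refine Or.inl ⟨i, j, hij, ?_⟩
    rcases hu with rfl | rfl <;> rcases hv with rfl | rfl
    · exact Or.inl rfl
    · exact Or.inr (Or.inr (Or.inl (sub_eq_add_neg _ _).symm))
    · exact Or.inr (Or.inr (Or.inr (by abel)))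
    · exact Or.inr (Or.inl (neg_add _ _).symm)

theorem sub_mem_roots {u v : Space n} (hu : u ∈ signedBasis n) (hv : v ∈ signedBasis n)
    (huv : u ≠ v) : u - v ∈ roots n := by
  rw [sub_eq_add_neg]
  exact add_mem_roots hu (neg_mem_signedBasis hv) (by rwa [neg_neg])

theorem finite_roots (n : ℕ) : (roots n).Finite := by
  refine ((finite_signedBasis n).image2 (· + ·) (finite_signedBasis n)).subset fun α hα => ?_
  obtain ⟨u, hu, v, hv, -, rfl⟩ := exists_eq_add_of_mem_roots hα
  exact ⟨u, hu, v, hv, rfl⟩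

theorem ne_zero_of_mem_roots {α : Space n} (h : α ∈ roots n) : α ≠ 0 := by
  obtain ⟨u, -, v, -, huv, rfl⟩ := exists_eq_add_of_mem_roots h
  exact fun h => huv (eq_neg_of_add_eq_zero_left h)

theorem neg_mem_roots {α : Space n} (h : α ∈ roots n) : -α ∈ roots n := by
  obtain ⟨u, hu, v, hv, huv, rfl⟩ := exists_eq_add_of_mem_roots h
  rw [neg_add]
  exact add_mem_roots (neg_mem_signedBasis hu) (neg_mem_signedBasis hv) (neg_injective.ne huv)

theorem inner_self_root {α : Space n} (h : α ∈ roots n) : ⟪α, α⟫ = 2 ∨ ⟪α, α⟫ = 4 := by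
  obtain ⟨u, hu, v, hv, huv, rfl⟩ := exists_eq_add_of_mem_roots h
  rw [real_inner_add_add_self, inner_self_signedBasis hu, inner_self_signedBasis hv]
  rcases signedBasis_cases hu hv with rfl | h | h
  · rw [inner_self_signedBasis hu]
    norm_num
  · exact absurd h huv
  · rw [h]
    norm_num

theorem eq_of_eq_natCast_smul {α β : Space n} (hα : α ∈ roots n) (hβ : β ∈ roots n) {c : ℕ}
    (h : α = (c : ℝ) • β) : α = β := by
  suffices c = 1 by rw [h, this, Nat.cast_one, one_smul]
  have hc : ⟪α, α⟫ = c * (c * ⟪β, β⟫) := by rw [h, real_inner_smul_left, real_inner_smul_right]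
  have hpos : c ≠ 0 := by
    rintro rfl
    exact ne_zero_of_mem_roots hα (by rw [h, Nat.cast_zero, zero_smul])
  have hlt : c < 2 := by
    by_contra! h2
    have h2 : (2 : ℝ) ≤ c := by exact_mod_cast h2
    rcases inner_self_root hα with h₁ | h₁ <;> rcases inner_self_root hβ with h₃ | h₃ <;>
      rw [h₁, h₃] at hc <;> nlinarith
  omega

theorem refl_add_left {u v : Space n} (hu : u ∈ signedBasis n) (hv : v ∈ signedBasis n)
    (huv : u ≠ -v) : refl (u + v) u = -v := by
  have hne : u + v ≠ 0 := fun h => huv (eq_neg_of_add_eq_zero_left h)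
  have h : 2 * ⟪u + v, u⟫ = ⟪u + v, u + v⟫ := by
    rw [real_inner_add_add_self, inner_add_left, inner_self_signedBasis hu,
      inner_self_signedBasis hv, real_inner_comm]
    ring
  rw [refl_apply, h, div_self (inner_self_ne_zero.2 hne), one_smul]
  abel

theorem refl_add_right {u v : Space n} (hu : u ∈ signedBasis n) (hv : v ∈ signedBasis n)
    (huv : u ≠ -v) : refl (u + v) v = -u := by
  rw [add_comm]
  exact refl_add_left hv hu fun h => huv (by rw [h, neg_neg])

theorem refl_sub_left {u v : Space n} (hu : u ∈ signedBasis n) (hv : v ∈ signedBasis n)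
    (h : u ≠ v) : refl (u - v) u = v := by
  rw [sub_eq_add_neg, refl_add_left hu (neg_mem_signedBasis hv) (by rwa [neg_neg]), neg_neg]

theorem refl_add_of_inner_eq_zero {u v b : Space n} (hu : ⟪u, b⟫ = 0) (hv : ⟪v, b⟫ = 0) :
    refl (u + v) b = b :=
  refl_eq_self_iff.2 (by rw [inner_add_left, hu, hv, add_zero])

theorem mapsTo_refl_signedBasis {α : Space n} (hα : α ∈ roots n) :
    Set.MapsTo (refl α) (signedBasis n) (signedBasis n) := by
  intro b hb
  obtain ⟨u, hu, v, hv, huv, rfl⟩ := exists_eq_add_of_mem_roots hα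
  rcases signedBasis_cases hb hu with rfl | rfl | h₁
  · rw [refl_add_left hb hv huv]
    exact neg_mem_signedBasis hv
  · rwa [map_neg, refl_add_left hu hv huv, neg_neg]
  rcases signedBasis_cases hb hv with rfl | rfl | h₂
  · rw [refl_add_right hu hb huv]
    exact neg_mem_signedBasis hu
  · rwa [map_neg, refl_add_right hu hv huv, neg_neg]
  · rwa [refl_add_of_inner_eq_zero (by rwa [real_inner_comm]) (by rwa [real_inner_comm])]

theorem mapsTo_roots {g : Isom n} (hg : Set.MapsTo g (signedBasis n) (signedBasis n)) :
    Set.MapsTo g (roots n) (roots n) := by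
  intro α hα
  obtain ⟨u, hu, v, hv, huv, rfl⟩ := exists_eq_add_of_mem_roots hα
  rw [map_add]
  refine add_mem_roots (hg hu) (hg hv) ?_
  rw [← map_neg]
  exact g.injective.ne huv

end SignedBasis

/-! ### Simple and positive roots -/

section SimpleRoots

variable {n : ℕ}

theorem simpleRoot_of_lt {i : ℕ} (h : i + 1 < n) :
    simpleRoot (⟨i, by omega⟩ : Fin n) = e ⟨i, by omega⟩ - e ⟨i + 1, h⟩ :=
  dif_pos h

theorem simpleRoot_last {i : Fin n} (h : ¬(i : ℕ) + 1 < n) : simpleRoot i = (2 : ℝ) • e i :=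
  dif_neg h

theorem simpleRoot_mem_roots (i : Fin n) : simpleRoot i ∈ roots n := by
  unfold simpleRoot
  split_ifs with h
  · exact Or.inl ⟨i, ⟨i + 1, h⟩, Fin.ne_of_val_ne (by simp), Or.inr (Or.inr (Or.inl rfl))⟩
  · exact Or.inr ⟨i, Or.inl rfl⟩

theorem simpleRoot_mem_posRoots (i : Fin n) : simpleRoot i ∈ posRoots n :=
  ⟨simpleRoot_mem_roots i, Pi.single i 1, by simp [Pi.single_apply]⟩

/-- The `k`-th fundamental coweight `e_1 + ⋯ + e_k`, up to a positive scalar: pairing with it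
reads off the coefficient of the `k`-th simple root. -/
def coweight (k : Fin n) : Space n := ∑ i ∈ Finset.Iic k, e i

theorem inner_e_coweight (i k : Fin n) : ⟪e i, coweight k⟫ = if i ≤ k then 1 else 0 := by
  simp [coweight, inner_sum, inner_e_e]

theorem inner_simpleRoot_coweight_of_ne {i k : Fin n} (h : i ≠ k) :
    ⟪simpleRoot i, coweight k⟫ = 0 := by
  have h' : (i : ℕ) ≠ k := Fin.val_ne_of_ne h
  unfold simpleRoot
  split_ifs with hi
  · simp only [inner_sub_left, inner_e_coweight, Fin.le_def]
    split_ifs <;> first | omega | norm_num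
  · rw [real_inner_smul_left, inner_e_coweight, if_neg (by rw [Fin.le_def]; omega), mul_zero]

theorem inner_simpleRoot_coweight_pos (i : Fin n) : 0 < ⟪simpleRoot i, coweight i⟫ := by
  unfold simpleRoot
  split_ifs with hi
  · simp [inner_sub_left, inner_e_coweight, Fin.le_def]
  · simp [real_inner_smul_left, inner_e_coweight]

theorem inner_sum_simpleRoot_coweight (c : Fin n → ℝ) (k : Fin n) :
    ⟪∑ i, c i • simpleRoot i, coweight k⟫ = c k * ⟪simpleRoot k, coweight k⟫ := by
  rw [sum_inner, Finset.sum_eq_single k]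
  · exact real_inner_smul_left _ _ _
  · intro i _ hi
    rw [real_inner_smul_left, inner_simpleRoot_coweight_of_ne hi, mul_zero]
  · simp

/-- The nonnegative integral combinations of simple roots; the positive roots are the roots
among them. -/
def simpleCone (n : ℕ) : AddSubmonoid (Space n) where
  carrier := {v | ∃ c : Fin n → ℕ, v = ∑ i, (c i : ℝ) • simpleRoot i}
  zero_mem' := ⟨0, by simp⟩
  add_mem' := by
    rintro _ _ ⟨c, rfl⟩ ⟨d, rfl⟩
    exact ⟨c + d, by simp [add_smul, Finset.sum_add_distrib]⟩

theorem simpleRoot_mem_simpleCone (i : Fin n) : simpleRoot i ∈ simpleCone n :=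
  (simpleRoot_mem_posRoots i).2

theorem e_sub_e_mem_simpleCone {i j : Fin n} (h : i ≤ j) : e i - e j ∈ simpleCone n := by
  obtain ⟨i, hi⟩ := i
  obtain ⟨j, hj⟩ := j
  rw [Fin.mk_le_mk] at h
  induction j, h using Nat.le_induction with
  | base =>
    rw [sub_self]
    exact zero_mem _
  | succ j _ ih =>
    have := simpleRoot_mem_simpleCone (⟨j, by omega⟩ : Fin n)
    rw [simpleRoot_of_lt hj] at this
    rw [← sub_add_sub_cancel]
    exact add_mem (ih (by omega)) this

theorem two_smul_e_mem_simpleCone (i : Fin n) : (2 : ℝ) • e i ∈ simpleCone n := by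
  have hi := i.2
  let m : Fin n := ⟨n - 1, by omega⟩
  have him : e i - e m ∈ simpleCone n :=
    e_sub_e_mem_simpleCone (Fin.mk_le_of_le_val (by simp only [m]; omega))
  have hm := simpleRoot_mem_simpleCone m
  rw [simpleRoot_last (by simp only [m]; omega)] at hm
  have : (2 : ℝ) • e i = (e i - e m) + (e i - e m) + (2 : ℝ) • e m := by module
  rw [this]
  exact add_mem (add_mem him him) hm

theorem e_add_e_mem_simpleCone (i j : Fin n) : e i + e j ∈ simpleCone n := by
  wlog h : i ≤ j generalizing i j
  · rw [add_comm]
    exact this j i (le_of_not_ge h)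
  have : e i + e j = (e i - e j) + (2 : ℝ) • e j := by module
  rw [this]
  exact add_mem (e_sub_e_mem_simpleCone h) (two_smul_e_mem_simpleCone j)

theorem mem_simpleCone_or_neg_mem {α : Space n} (h : α ∈ roots n) :
    α ∈ simpleCone n ∨ -α ∈ simpleCone n := by
  have sub_mem (i j : Fin n) : e i - e j ∈ simpleCone n ∨ e j - e i ∈ simpleCone n :=
    (le_total i j).imp e_sub_e_mem_simpleCone e_sub_e_mem_simpleCone
  rcases h with ⟨i, j, -, rfl | rfl | rfl | rfl⟩ | ⟨i, rfl | rfl⟩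
  · exact Or.inl (e_add_e_mem_simpleCone i j)
  · exact Or.inr ((neg_neg (e i + e j)).symm ▸ e_add_e_mem_simpleCone i j)
  · exact (neg_sub (e i) (e j)).symm ▸ sub_mem i j
  · rw [neg_neg, neg_sub]
    exact sub_mem j i
  · exact Or.inl (two_smul_e_mem_simpleCone i)
  · exact Or.inr ((neg_neg ((2 : ℝ) • e i)).symm ▸ two_smul_e_mem_simpleCone i)

theorem mem_posRoots_or_neg_mem {α : Space n} (h : α ∈ roots n) :
    α ∈ posRoots n ∨ -α ∈ posRoots n :=
  (mem_simpleCone_or_neg_mem h).imp (fun h' => ⟨h, h'⟩) fun h' => ⟨neg_mem_roots h, h'⟩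

theorem inner_coweight_nonneg {α : Space n} (h : α ∈ posRoots n) (k : Fin n) :
    0 ≤ ⟪α, coweight k⟫ := by
  obtain ⟨-, c, rfl⟩ := h
  rw [inner_sum_simpleRoot_coweight]
  exact mul_nonneg (Nat.cast_nonneg _) (inner_simpleRoot_coweight_pos k).le

theorem exists_eq_natCast_smul_simpleRoot {v : Space n} (hv : v ∈ simpleCone n) {i : Fin n}
    (h : ∀ k, k ≠ i → ⟪v, coweight k⟫ = 0) : ∃ c : ℕ, v = (c : ℝ) • simpleRoot i := by
  obtain ⟨c, rfl⟩ := hv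
  refine ⟨c i, Finset.sum_eq_single i (fun k _ hk => ?_) (by simp)⟩
  have := h k hk
  rw [inner_sum_simpleRoot_coweight] at this
  rw [(mul_eq_zero.1 this).resolve_right (inner_simpleRoot_coweight_pos k).ne', zero_smul]

theorem exists_inner_coweight_pos {α : Space n} (h : α ∈ posRoots n) :
    ∃ k, 0 < ⟪α, coweight k⟫ := by
  by_contra! h'
  obtain ⟨hα, c, rfl⟩ := h
  refine ne_zero_of_mem_roots hα (Finset.sum_eq_zero fun k _ => ?_)
  have := (h' k).antisymm (inner_coweight_nonneg ⟨hα, c, rfl⟩ k)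
  rw [inner_sum_simpleRoot_coweight] at this
  rw [(mul_eq_zero.1 this).resolve_right (inner_simpleRoot_coweight_pos k).ne', zero_smul]

theorem neg_notMem_posRoots {α : Space n} (h : α ∈ posRoots n) : -α ∉ posRoots n := by
  intro h'
  obtain ⟨k, hk⟩ := exists_inner_coweight_pos h
  have := inner_coweight_nonneg h' k
  rw [inner_neg_left] at this
  linarith

theorem refl_simpleRoot_mem_posRoots {α : Space n} (hα : α ∈ posRoots n) {i : Fin n}
    (hi : α ≠ simpleRoot i) : refl (simpleRoot i) α ∈ posRoots n := by
  have hr : refl (simpleRoot i) α ∈ roots n :=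
    mapsTo_roots (mapsTo_refl_signedBasis (simpleRoot_mem_roots i)) hα.1
  refine (mem_posRoots_or_neg_mem hr).resolve_right fun hneg => hi ?_
  have h₀ (k) (hk : k ≠ i) : ⟪α, coweight k⟫ = 0 := by
    have h₁ := inner_coweight_nonneg hα k
    have h₂ := inner_coweight_nonneg hneg k
    rw [inner_neg_left, inner_refl_left,
      refl_eq_self_iff.2 (inner_simpleRoot_coweight_of_ne hk.symm)] at h₂
    linarith
  obtain ⟨c, hc⟩ := exists_eq_natCast_smul_simpleRoot hα.2 h₀
  exact eq_of_eq_natCast_smul hα.1 (simpleRoot_mem_roots i) hc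

end SimpleRoots

/-! ### Words, length and the exchange property -/

section Words

variable {n : ℕ}

/-- The product of the simple reflections listed in `l`. -/
def word (l : List (Fin n)) : Isom n := (l.map fun i => refl (simpleRoot i)).prod

theorem word_cons (i : Fin n) (l : List (Fin n)) :
    word (i :: l) = refl (simpleRoot i) * word l := by
  simp [word]

theorem word_append (l l' : List (Fin n)) : word (l ++ l') = word l * word l' := by
  simp [word]

theorem word_inv (l : List (Fin n)) : (word l)⁻¹ = word l.reverse := by
  simp only [word, List.prod_inv_reverse, List.map_map, List.map_reverse]
  congr 3

theorem refl_mem_parabolic {J : Set (Fin n)} {i : Fin n} (hi : i ∈ J) :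
    refl (simpleRoot i) ∈ parabolic J :=
  Subgroup.subset_closure ⟨i, hi, rfl⟩

theorem word_mem_parabolic {J : Set (Fin n)} {l : List (Fin n)} (hl : ∀ i ∈ l, i ∈ J) :
    word l ∈ parabolic J := by
  refine Subgroup.list_prod_mem _ fun x hx => ?_
  obtain ⟨i, hi, rfl⟩ := List.mem_map.1 hx
  exact refl_mem_parabolic (hl i hi)

theorem word_mem_weyl (l : List (Fin n)) : word l ∈ weyl n :=
  word_mem_parabolic fun _ _ => Set.mem_univ _

theorem exists_word {J : Set (Fin n)} {w : Isom n} (hw : w ∈ parabolic J) :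
    ∃ l : List (Fin n), (∀ i ∈ l, i ∈ J) ∧ word l = w := by
  induction hw using Subgroup.closure_induction with
  | mem x hx =>
    obtain ⟨i, hi, rfl⟩ := hx
    exact ⟨[i], by simpa using hi, by simp [word]⟩
  | one => exact ⟨[], by simp, rfl⟩
  | mul x y _ _ hx hy =>
    obtain ⟨l, hl, rfl⟩ := hx
    obtain ⟨l', hl', rfl⟩ := hy
    refine ⟨l ++ l', fun i hi => ?_, word_append l l'⟩
    exact (List.mem_append.1 hi).elim (hl i) (hl' i)
  | inv x _ hx =>
    obtain ⟨l, hl, rfl⟩ := hx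
    exact ⟨l.reverse, by simpa using hl, (word_inv l).symm⟩

theorem parabolic_le_weyl (J : Set (Fin n)) : parabolic J ≤ weyl n :=
  Subgroup.closure_mono (Set.image_mono (Set.subset_univ J))

theorem parabolic_empty : parabolic (∅ : Set (Fin n)) = ⊥ := by
  rw [parabolic, Set.image_empty, Subgroup.closure_empty]

theorem mapsTo_signedBasis {w : Isom n} (hw : w ∈ weyl n) :
    Set.MapsTo w (signedBasis n) (signedBasis n) := by
  obtain ⟨l, -, rfl⟩ := exists_word hw
  induction l with
  | nil => exact fun u hu => hu
  | cons i l ih =>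
    rw [word_cons]
    exact (mapsTo_refl_signedBasis (simpleRoot_mem_roots i)).comp (ih (word_mem_weyl l))

theorem map_mem_roots {w : Isom n} (hw : w ∈ weyl n) {α : Space n} (hα : α ∈ roots n) :
    w α ∈ roots n :=
  mapsTo_roots (mapsTo_signedBasis hw) hα

theorem exchange {l : List (Fin n)} {α : Space n} (hα : α ∈ posRoots n)
    (hl : -(word l α) ∈ posRoots n) :
    ∃ l' : List (Fin n), l'.Sublist l ∧ l'.length < l.length ∧ word l * refl α = word l' := by
  induction l with
  | nil => exact absurd hl (neg_notMem_posRoots hα)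
  | cons i l ih =>
    rcases mem_posRoots_or_neg_mem (map_mem_roots (word_mem_weyl l) hα.1) with h | h
    · have hi : word l α = simpleRoot i := by
        by_contra hne
        rw [word_cons] at hl
        exact neg_notMem_posRoots (refl_simpleRoot_mem_posRoots h hne) hl
      refine ⟨l, List.sublist_cons_self i l, by simp, ?_⟩
      rw [word_cons, mul_assoc, mul_refl, hi, ← mul_assoc, refl_mul_self, one_mul]
    · obtain ⟨l', hsub, hlen, hword⟩ := ih h
      refine ⟨i :: l', hsub.cons_cons i, by simpa using hlen, ?_⟩
      rw [word_cons, word_cons, mul_assoc, hword]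

theorem length_word_le (l : List (Fin n)) : length (word l) ≤ l.length :=
  Nat.sInf_le ⟨l, rfl, rfl⟩

theorem exists_reduced_word {w : Isom n} (hw : w ∈ weyl n) :
    ∃ l : List (Fin n), l.length = length w ∧ word l = w := by
  obtain ⟨l, -, hl⟩ := exists_word hw
  exact Nat.sInf_mem (s := {k | ∃ l : List (Fin n), l.length = k ∧ word l = w}) ⟨_, l, rfl, hl⟩

theorem length_inv {w : Isom n} (hw : w ∈ weyl n) : length w⁻¹ = length w := by
  have length_inv_le {w : Isom n} (hw : w ∈ weyl n) : length w⁻¹ ≤ length w := by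
    obtain ⟨l, hl, rfl⟩ := exists_reduced_word hw
    rw [← hl, word_inv, ← List.length_reverse]
    exact length_word_le _
  exact (length_inv_le hw).antisymm (by simpa only [inv_inv] using length_inv_le (inv_mem hw))

theorem length_mul_refl_lt {w : Isom n} (hw : w ∈ weyl n) {α : Space n} (hα : α ∈ posRoots n)
    (h : -(w α) ∈ posRoots n) : length (w * refl α) < length w := by
  obtain ⟨l, hl, rfl⟩ := exists_reduced_word hw
  obtain ⟨l', -, hlen, hword⟩ := exchange hα h
  rw [← hl, hword]
  exact (length_word_le l').trans_lt hlen

/-- The hypothesis `b (simpleRoot i) ∈ posRoots n` says that appending the `i`-th simple reflection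
lengthens `b`, so this is an induction along reduced words. -/
theorem parabolic_induction {J : Set (Fin n)} {p : Isom n → Prop} (one : p 1)
    (mul : ∀ b ∈ parabolic J, ∀ i ∈ J, b (simpleRoot i) ∈ posRoots n → p b →
      p (b * refl (simpleRoot i)))
    {b : Isom n} (hb : b ∈ parabolic J) : p b := by
  suffices ∀ (k : ℕ) (l : List (Fin n)), (∀ i ∈ l, i ∈ J) → l.length = k → p (word l) by
    obtain ⟨l, hl, rfl⟩ := exists_word hb
    exact this _ l hl rfl
  intro k
  induction k using Nat.strong_induction_on with
  | _ k ih =>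
    intro l hl hk
    rcases List.eq_nil_or_concat l with rfl | ⟨l, i, rfl⟩
    · exact one
    rw [List.concat_eq_append] at hl hk ⊢
    have hlJ : ∀ j ∈ l, j ∈ J := fun j hj => hl j (List.mem_append_left _ hj)
    have hi : i ∈ J := hl i (by simp)
    have hk' : l.length + 1 = k := by simpa using hk
    have hword : word (l ++ [i]) = word l * refl (simpleRoot i) := by
      simp only [word, List.map_append, List.prod_append, List.map_singleton, List.prod_singleton]
    rw [hword]
    rcases mem_posRoots_or_neg_mem (map_mem_roots (word_mem_weyl l) (simpleRoot_mem_roots i))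
      with h | h
    · exact mul _ (word_mem_parabolic hlJ) i hi h (ih _ (by omega) l hlJ rfl)
    · obtain ⟨l', hsub, hlen, heq⟩ := exchange (simpleRoot_mem_posRoots i) h
      rw [heq]
      exact ih _ (by omega) l' (fun j hj => hlJ j (hsub.subset hj)) rfl

end Words

/-! ### Dominant vectors and their stabilizers -/

section Dominant

variable {n : ℕ}

open Classical in
/-- A dominant vector orthogonal to exactly the simple roots with index in `P`. Its stabilizer in
`W` is `W_P`, so `w ↦ w (dominantVector P)` identifies `W / W_P` with an orbit of `W`. -/
def dominantVector (P : Set (Fin n)) : Space n := ∑ k, if k ∈ P then 0 else coweight k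

theorem inner_simpleRoot_dominantVector_of_mem {P : Set (Fin n)} {i : Fin n} (hi : i ∈ P) :
    ⟪simpleRoot i, dominantVector P⟫ = 0 := by
  rw [dominantVector, inner_sum]
  refine Finset.sum_eq_zero fun k _ => ?_
  split_ifs with hk
  · exact inner_zero_right _
  · exact inner_simpleRoot_coweight_of_ne fun h => hk (h ▸ hi)

theorem inner_simpleRoot_dominantVector_pos {P : Set (Fin n)} {i : Fin n} (hi : i ∉ P) :
    0 < ⟪simpleRoot i, dominantVector P⟫ := by
  rw [dominantVector, inner_sum, Finset.sum_eq_single i, if_neg hi]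
  · exact inner_simpleRoot_coweight_pos i
  · intro k _ hk
    split_ifs
    · exact inner_zero_right _
    · exact inner_simpleRoot_coweight_of_ne hk.symm
  · simp

theorem inner_dominantVector_nonneg (P : Set (Fin n)) {α : Space n} (hα : α ∈ posRoots n) :
    0 ≤ ⟪α, dominantVector P⟫ := by
  rw [dominantVector, inner_sum]
  refine Finset.sum_nonneg fun k _ => ?_
  split_ifs
  · exact (inner_zero_right _).ge
  · exact inner_coweight_nonneg hα k

theorem mem_posRoots_of_inner_dominantVector_pos {P : Set (Fin n)} {α : Space n}
    (hα : α ∈ roots n) (h : 0 < ⟪α, dominantVector P⟫) : α ∈ posRoots n := by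
  refine (mem_posRoots_or_neg_mem hα).resolve_right fun h' => ?_
  have := inner_dominantVector_nonneg P h'
  rw [inner_neg_left] at this
  linarith

theorem exists_inner_simpleRoot_pos {α : Space n} (hα : α ∈ posRoots n) :
    ∃ i, 0 < ⟪simpleRoot i, α⟫ := by
  by_contra! h
  obtain ⟨hr, c, hc⟩ := hα
  refine ne_zero_of_mem_roots hr (real_inner_self_nonpos.1 ?_)
  conv_lhs => rw [hc, sum_inner, ← hc]
  refine Finset.sum_nonpos fun i _ => ?_
  rw [real_inner_smul_left]
  exact mul_nonpos_of_nonneg_of_nonpos (Nat.cast_nonneg _) (h i)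

theorem exists_map_eq_simpleRoot {α : Space n} (hα : α ∈ posRoots n) :
    ∃ w ∈ weyl n, ∃ i, w α = simpleRoot i := by
  -- Among the positive conjugates of `α`, one of least height is simple.
  have hfin : {β | β ∈ posRoots n ∧ ∃ w ∈ weyl n, w α = β}.Finite :=
    (finite_roots n).subset fun β hβ => hβ.1.1
  obtain ⟨β, ⟨hβ, w, hw, hwα⟩, hmin⟩ := Set.exists_min_image _
    (fun β : Space n => ⟪β, dominantVector ∅⟫) hfin ⟨α, hα, 1, one_mem (weyl n), rfl⟩
  obtain ⟨i, hi⟩ := exists_inner_simpleRoot_pos hβ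
  refine ⟨w, hw, i, ?_⟩
  by_contra hne
  have hle := hmin (refl (simpleRoot i) β) ⟨refl_simpleRoot_mem_posRoots hβ (hwα ▸ hne),
    refl (simpleRoot i) * w, mul_mem (refl_mem_parabolic (Set.mem_univ i)) hw,
    congrArg (refl (simpleRoot i)) hwα⟩
  have hdec : 0 < 2 * ⟪simpleRoot i, β⟫ / ⟪simpleRoot i, simpleRoot i⟫ :=
    div_pos (by linarith)
      (real_inner_self_pos.2 (ne_zero_of_mem_roots (simpleRoot_mem_roots i)))
  rw [refl_apply, inner_sub_left, real_inner_smul_left] at hle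
  have := mul_pos hdec (inner_simpleRoot_dominantVector_pos (Set.notMem_empty i))
  linarith

theorem refl_mem_weyl {α : Space n} (h : α ∈ roots n) : refl α ∈ weyl n := by
  wlog hα : α ∈ posRoots n generalizing α
  · rw [← refl_neg]
    exact this (neg_mem_roots h) ((mem_posRoots_or_neg_mem h).resolve_left hα)
  obtain ⟨w, hw, i, hwα⟩ := exists_map_eq_simpleRoot hα
  rw [← inv_apply_eq.2 hwα.symm, refl_map, inv_inv]
  exact mul_mem (mul_mem (inv_mem hw) (refl_mem_parabolic (Set.mem_univ i))) hw

theorem map_eq_self_of_mem_parabolic {J : Set (Fin n)} {v : Space n}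
    (hv : ∀ i ∈ J, ⟪simpleRoot i, v⟫ = 0) {b : Isom n} (hb : b ∈ parabolic J) : b v = v := by
  refine parabolic_induction (p := fun b => b v = v) rfl (fun b _ i hi _ h => ?_) hb
  rw [isom_mul_apply, refl_eq_self_iff.2 (hv i hi), h]

theorem mem_parabolic_iff {P : Set (Fin n)} {w : Isom n} :
    w ∈ parabolic P ↔ w ∈ weyl n ∧ w (dominantVector P) = dominantVector P := by
  refine ⟨fun h => ⟨parabolic_le_weyl P h, map_eq_self_of_mem_parabolic
    (fun _ hi => inner_simpleRoot_dominantVector_of_mem hi) h⟩, fun ⟨hw, h⟩ => ?_⟩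
  refine parabolic_induction
    (p := fun b => b (dominantVector P) = dominantVector P → b ∈ parabolic P)
    (fun _ => one_mem _) (fun b _ i _ hpos ih h => ?_) hw h
  rw [isom_mul_apply] at h
  have hneg : ⟪simpleRoot i, dominantVector P⟫ = -⟪b (simpleRoot i), dominantVector P⟫ := by
    conv_rhs => rw [← h]
    rw [LinearIsometryEquiv.inner_map_map, inner_self_refl, neg_neg]
  have hi : i ∈ P := by
    by_contra hi
    have := inner_simpleRoot_dominantVector_pos hi
    have := inner_dominantVector_nonneg P hpos
    linarith
  rw [refl_eq_self_iff.2 (inner_simpleRoot_dominantVector_of_mem hi)] at h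
  exact mul_mem (ih h) (refl_mem_parabolic hi)

theorem map_dominantVector {P : Set (Fin n)} {b : Isom n} (hb : b ∈ parabolic P) :
    b (dominantVector P) = dominantVector P :=
  (mem_parabolic_iff.1 hb).2

theorem eq_one_of_map_dominantVector_empty {w : Isom n} (hw : w ∈ weyl n)
    (h : w (dominantVector ∅) = dominantVector ∅) : w = 1 := by
  have : w ∈ parabolic (∅ : Set (Fin n)) := mem_parabolic_iff.2 ⟨hw, h⟩
  rwa [parabolic_empty, Subgroup.mem_bot] at this

theorem inner_map_simpleRoot_nonneg {J : Set (Fin n)} {v : Space n}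
    (hv : ∀ i ∈ J, 0 ≤ ⟪simpleRoot i, v⟫) {b : Isom n} (hb : b ∈ parabolic J) {i : Fin n}
    (hi : i ∈ J) (hpos : b (simpleRoot i) ∈ posRoots n) : 0 ≤ ⟪b (simpleRoot i), v⟫ := by
  have h₀ (k) (hk : k ∉ J) : ⟪b (simpleRoot i), coweight k⟫ = 0 := by
    rw [inner_map_left, map_eq_self_of_mem_parabolic (J := J) _ (inv_mem hb)]
    · exact inner_simpleRoot_coweight_of_ne fun h => hk (h ▸ hi)
    · exact fun j hj => inner_simpleRoot_coweight_of_ne fun h => hk (h ▸ hj)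
  obtain ⟨-, c, hc⟩ := hpos
  rw [hc, sum_inner]
  refine Finset.sum_nonneg fun k _ => ?_
  rw [real_inner_smul_left]
  by_cases hk : k ∈ J
  · exact mul_nonneg (Nat.cast_nonneg _) (hv k hk)
  · have := h₀ k hk
    rw [hc, inner_sum_simpleRoot_coweight] at this
    rw [(mul_eq_zero.1 this).resolve_right (inner_simpleRoot_coweight_pos k).ne', zero_mul]

theorem inner_map_le {J : Set (Fin n)} {v v' : Space n} (hv : ∀ i ∈ J, 0 ≤ ⟪simpleRoot i, v⟫)
    (hv' : ∀ i ∈ J, 0 ≤ ⟪simpleRoot i, v'⟫) {b : Isom n} (hb : b ∈ parabolic J) :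
    ⟪b v, v'⟫ ≤ ⟪v, v'⟫ := by
  refine parabolic_induction (p := fun b => ⟪b v, v'⟫ ≤ ⟪v, v'⟫) le_rfl
    (fun b hb i hi hpos ih => le_trans ?_ ih) hb
  rw [isom_mul_apply, refl_apply, map_sub, map_smul, inner_sub_left,
    real_inner_smul_left]
  have h : 0 ≤ 2 * ⟪simpleRoot i, v⟫ / ⟪simpleRoot i, simpleRoot i⟫ :=
    div_nonneg (mul_nonneg zero_le_two (hv i hi)) real_inner_self_nonneg
  linarith [mul_nonneg h (inner_map_simpleRoot_nonneg hv' hb hi hpos)]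

theorem map_eq_self_of_dominant {J : Set (Fin n)} {v : Space n} {b : Isom n}
    (hb : b ∈ parabolic J) (hv : ∀ i ∈ J, 0 ≤ ⟪simpleRoot i, v⟫)
    (hbv : ∀ i ∈ J, 0 ≤ ⟪simpleRoot i, b v⟫) : b v = v := by
  have hle : ⟪b v, b v⟫ ≤ ⟪v, b v⟫ := inner_map_le hv hbv hb
  refine sub_eq_zero.1 (real_inner_self_nonpos.1 ?_)
  rw [LinearIsometryEquiv.inner_map_map] at hle
  rw [real_inner_sub_sub_self, LinearIsometryEquiv.inner_map_map]
  linarith [real_inner_comm v (b v)]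

end Dominant

/-! ### The Bruhat order -/

section Bruhat

variable {n : ℕ} {w : Isom n}

theorem length_refl_mul_lt (hw : w ∈ weyl n) {α : Space n} (hα : α ∈ posRoots n)
    (h : -(w⁻¹ α) ∈ posRoots n) : length (refl α * w) < length w := by
  have hlt := length_mul_refl_lt (inv_mem hw) hα h
  rwa [length_inv hw, ← refl_inv α, ← mul_inv_rev,
    length_inv (mul_mem (refl_mem_weyl hα.1) hw)] at hlt

theorem length_lt_refl_mul (hw : w ∈ weyl n) {α : Space n} (hα : α ∈ posRoots n)
    (h : w⁻¹ α ∈ posRoots n) : length w < length (refl α * w) := by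
  have hlt := length_refl_mul_lt (mul_mem (refl_mem_weyl hα.1) hw) hα (by
    rwa [mul_inv_rev, refl_inv, isom_mul_apply, refl_self, map_neg, neg_neg])
  rwa [← mul_assoc, refl_mul_self, one_mul] at hlt

theorem length_le_of_bruhatLE {x y : Isom n} (h : BruhatLE x y) : length x ≤ length y := by
  induction h with
  | refl => exact le_rfl
  | tail _ hyz ih =>
    obtain ⟨-, α, -, -, hlt⟩ := hyz
    exact ih.trans hlt.le

theorem bruhatLE_refl_mul_iff (hw : w ∈ weyl n) {α : Space n} (hα : α ∈ posRoots n) :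
    BruhatLE w (refl α * w) ↔ w⁻¹ α ∈ posRoots n := by
  constructor
  · intro h
    refine (mem_posRoots_or_neg_mem (map_mem_roots (inv_mem hw) hα.1)).resolve_right fun h' => ?_
    exact (length_refl_mul_lt hw hα h').not_ge (length_le_of_bruhatLE h)
  · intro h
    exact Relation.ReflTransGen.single ⟨hw, α, hα.1, rfl, length_lt_refl_mul hw hα h⟩

end Bruhat

/-! ### Cosets and orbits of dominant vectors -/

section Cosets

variable {n : ℕ} {P Q : Set (Fin n)}

theorem doubleCoset_empty_left (P : Set (Fin n)) (w : Isom n) :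
    doubleCoset ∅ P w = leftCoset P w := by
  simp only [doubleCoset, leftCoset, parabolic_empty, Subgroup.mem_bot, exists_eq_left, one_mul]

theorem minDouble_empty_left (P : Set (Fin n)) : minDouble ∅ P = minLeft P := by
  simp only [minDouble, minLeft, doubleCoset_empty_left]

theorem hat_empty_left (P : Set (Fin n)) (w : Isom n) : hat ∅ P w = bar P w := by
  simp only [hat, bar, doubleCoset_empty_left]

theorem doubleCoset_eq_mathlib (Q P : Set (Fin n)) (w : Isom n) :
    doubleCoset Q P w = DoubleCoset.doubleCoset w (parabolic Q) (parabolic P) :=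
  Set.ext fun _ => DoubleCoset.mem_doubleCoset.symm

theorem doubleCoset_eq_of_mem {w w' : Isom n} (h : w' ∈ doubleCoset Q P w) :
    doubleCoset Q P w' = doubleCoset Q P w := by
  rw [doubleCoset_eq_mathlib] at h ⊢
  rw [doubleCoset_eq_mathlib, DoubleCoset.doubleCoset_eq_of_mem h]

theorem mem_doubleCoset_iff {w w' : Isom n} (hw : w ∈ weyl n) (hw' : w' ∈ weyl n) :
    w' ∈ doubleCoset Q P w ↔
      ∃ a ∈ parabolic Q, w' (dominantVector P) = a (w (dominantVector P)) := by
  constructor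
  · rintro ⟨a, ha, b, hb, rfl⟩
    refine ⟨a, ha, ?_⟩
    rw [isom_mul_apply, map_dominantVector hb, isom_mul_apply]
  · rintro ⟨a, ha, h⟩
    have haw := mul_mem (parabolic_le_weyl _ ha) hw
    refine ⟨a, ha, (a * w)⁻¹ * w', mem_parabolic_iff.2 ⟨mul_mem (inv_mem haw) hw', ?_⟩, by group⟩
    exact inv_apply_eq.2 h

theorem hat_mem_doubleCoset (Q P : Set (Fin n)) (w : Isom n) : hat Q P w ∈ doubleCoset Q P w :=
  Function.argminOn_mem _ _ _

theorem hat_mem_minDouble {w : Isom n} (hw : w ∈ weyl n) : hat Q P w ∈ minDouble Q P := by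
  refine ⟨?_, fun x hx => ?_⟩
  · obtain ⟨a, ha, b, hb, h⟩ := hat_mem_doubleCoset Q P w
    rw [h]
    exact mul_mem (mul_mem (parabolic_le_weyl _ ha) hw) (parabolic_le_weyl _ hb)
  · rw [doubleCoset_eq_of_mem (hat_mem_doubleCoset Q P w)] at hx
    exact Function.argminOn_le _ _ hx

theorem hat_eq_hat_iff {w w' : Isom n} (hw : w ∈ weyl n) (hw' : w' ∈ weyl n) :
    hat Q P w' = hat Q P w ↔
      ∃ a ∈ parabolic Q, w' (dominantVector P) = a (w (dominantVector P)) := by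
  rw [← mem_doubleCoset_iff hw hw']
  constructor
  · intro h
    have hcoset := doubleCoset_eq_of_mem (hat_mem_doubleCoset Q P w')
    rw [h, doubleCoset_eq_of_mem (hat_mem_doubleCoset Q P w)] at hcoset
    rw [hcoset]
    exact ⟨1, one_mem _, 1, one_mem _, by group⟩
  · intro h
    simp only [hat, doubleCoset_eq_of_mem h]

theorem exists_map_hat_dominantVector (Q P : Set (Fin n)) {w : Isom n} (hw : w ∈ weyl n) :
    ∃ a ∈ parabolic Q, a (hat Q P w (dominantVector P)) = w (dominantVector P) := by
  obtain ⟨a, ha, h⟩ :=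
    (mem_doubleCoset_iff hw (hat_mem_minDouble hw).1).1 (hat_mem_doubleCoset Q P w)
  exact ⟨a⁻¹, inv_mem ha, by rw [h, inv_apply_self]⟩

theorem minDouble_subset_minLeft (Q P : Set (Fin n)) : minDouble Q P ⊆ minLeft P := by
  rintro w ⟨hw, hmin⟩
  refine ⟨hw, fun x hx => hmin x ?_⟩
  obtain ⟨b, hb, rfl⟩ := hx
  exact ⟨1, one_mem _, b, hb, by rw [one_mul]⟩

theorem map_simpleRoot_mem_posRoots {x : Isom n} (hx : x ∈ minLeft P) {i : Fin n} (hi : i ∈ P) :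
    x (simpleRoot i) ∈ posRoots n := by
  refine (mem_posRoots_or_neg_mem (map_mem_roots hx.1 (simpleRoot_mem_roots i))).resolve_right
    fun h => ?_
  exact (length_mul_refl_lt hx.1 (simpleRoot_mem_posRoots i) h).not_ge
    (hx.2 _ ⟨_, refl_mem_parabolic hi, rfl⟩)

theorem eq_of_mem_leftCoset {x x' : Isom n} (hx : x ∈ minLeft P) (hx' : x' ∈ minLeft P)
    (h : x' ∈ leftCoset P x) : x' = x := by
  obtain ⟨b, hb, rfl⟩ := h
  have hdom (y) (hy : y ∈ minLeft P) (i) (hi : i ∈ P) :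
      0 ≤ ⟪simpleRoot i, y⁻¹ (dominantVector ∅)⟫ := by
    rw [← inner_map_left]
    exact inner_dominantVector_nonneg ∅ (map_simpleRoot_mem_posRoots hy hi)
  have hfix : b⁻¹ (x⁻¹ (dominantVector ∅)) = x⁻¹ (dominantVector ∅) := by
    refine map_eq_self_of_dominant (inv_mem hb) (hdom x hx) ?_
    rw [← isom_mul_apply, ← mul_inv_rev]
    exact hdom _ hx'
  rw [inv_apply_eq, inv_apply_eq, ← isom_mul_apply,
    ← isom_mul_apply] at hfix
  have := eq_one_of_map_dominantVector_empty (mul_mem hx'.1 (inv_mem hx.1)) hfix.symm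
  exact mul_inv_eq_one.1 this

theorem inner_simpleRoot_nonneg_of_mem_minDouble {u : Isom n} (hu : u ∈ minDouble Q P)
    {i : Fin n} (hi : i ∈ Q) : 0 ≤ ⟪simpleRoot i, u (dominantVector P)⟫ := by
  rw [inner_map_right]
  refine inner_dominantVector_nonneg P ((mem_posRoots_or_neg_mem
    (map_mem_roots (inv_mem hu.1) (simpleRoot_mem_roots i))).resolve_right fun h => ?_)
  exact (length_refl_mul_lt hu.1 (simpleRoot_mem_posRoots i) h).not_ge
    (hu.2 _ ⟨_, refl_mem_parabolic hi, 1, one_mem _, by group⟩)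

theorem hat_eq_self {u : Isom n} (hu : u ∈ minDouble Q P) : hat Q P u = u := by
  have hu' := hat_mem_minDouble (Q := Q) (P := P) hu.1
  obtain ⟨a, ha, h⟩ := (mem_doubleCoset_iff hu.1 hu'.1).1 (hat_mem_doubleCoset Q P u)
  have hfix : a (u (dominantVector P)) = u (dominantVector P) :=
    map_eq_self_of_dominant ha (fun _ hi => inner_simpleRoot_nonneg_of_mem_minDouble hu hi)
      fun _ hi => h ▸ inner_simpleRoot_nonneg_of_mem_minDouble hu' hi
  refine eq_of_mem_leftCoset (minDouble_subset_minLeft Q P hu)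
    (minDouble_subset_minLeft Q P hu') ?_
  rw [← doubleCoset_empty_left]
  exact (mem_doubleCoset_iff hu.1 hu'.1).2 ⟨1, one_mem _, h.trans hfix⟩

theorem bar_mem_minLeft {w : Isom n} (hw : w ∈ weyl n) : bar P w ∈ minLeft P := by
  rw [← hat_empty_left, ← minDouble_empty_left]
  exact hat_mem_minDouble hw

theorem bar_eq_self {w : Isom n} (hw : w ∈ minLeft P) : bar P w = w := by
  rw [← hat_empty_left]
  exact hat_eq_self (by rwa [minDouble_empty_left])

theorem bar_eq_bar_iff {w w' : Isom n} (hw : w ∈ weyl n) (hw' : w' ∈ weyl n) :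
    bar P w' = bar P w ↔ w' (dominantVector P) = w (dominantVector P) := by
  rw [← hat_empty_left, ← hat_empty_left, hat_eq_hat_iff hw hw', parabolic_empty]
  simp only [Subgroup.mem_bot, exists_eq_left, LinearIsometryEquiv.coe_one, id_eq]

theorem bar_dominantVector {w : Isom n} (hw : w ∈ weyl n) :
    bar P w (dominantVector P) = w (dominantVector P) :=
  (bar_eq_bar_iff hw (bar_mem_minLeft hw).1).1 (bar_eq_self (bar_mem_minLeft hw))

end Cosets

/-! ### Closedness in terms of orbits -/

section Closedness

variable {n : ℕ} {P Q : Set (Fin n)}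

theorem inner_map_dominantVector {a : Isom n} (ha : a ∈ parabolic Q) (v : Space n) :
    ⟪a v, dominantVector Q⟫ = ⟪v, dominantVector Q⟫ := by
  rw [inner_map_left, map_dominantVector (inv_mem ha)]

theorem inner_refl_eq_inner_iff {α : Space n} (hα : α ≠ 0) (x y : Space n) :
    ⟪refl α y, x⟫ = ⟪y, x⟫ ↔ ⟪α, x⟫ = 0 ∨ ⟪α, y⟫ = 0 := by
  have hαα : ⟪α, α⟫ ≠ 0 := inner_self_ne_zero.2 hα
  rw [refl_apply, inner_sub_left, real_inner_smul_left, sub_eq_self, mul_eq_zero, div_eq_zero_iff,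
    mul_eq_zero, or_comm]
  simp only [two_ne_zero, hαα, false_or, or_false]

theorem refl_mem_parabolic_iff {α : Space n} (hα : α ∈ roots n) :
    refl α ∈ parabolic Q ↔ ⟪α, dominantVector Q⟫ = 0 := by
  rw [mem_parabolic_iff, refl_eq_self_iff, and_iff_right (refl_mem_weyl hα)]

theorem bar_mul_bar {a w : Isom n} (ha : a ∈ weyl n) (hw : w ∈ weyl n) :
    bar P (a * bar P w) = bar P (a * w) := by
  rw [bar_eq_bar_iff (mul_mem ha hw) (mul_mem ha (bar_mem_minLeft hw).1), isom_mul_apply,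
    bar_dominantVector hw, isom_mul_apply]

theorem bar_refl_mul_eq_bar_iff {w : Isom n} (hw : w ∈ weyl n) {α : Space n} (hα : α ∈ roots n) :
    bar P (refl α * w) = bar P w ↔ ⟪α, w (dominantVector P)⟫ = 0 := by
  rw [bar_eq_bar_iff hw (mul_mem (refl_mem_weyl hα) hw), isom_mul_apply, refl_eq_self_iff]

theorem hat_refl_mul_eq_hat_iff {w : Isom n} (hw : w ∈ weyl n) {α : Space n} (hα : α ∈ roots n) :
    hat Q P (refl α * w) = hat Q P w ↔
      ⟪α, dominantVector Q⟫ = 0 ∨ ⟪α, w (dominantVector P)⟫ = 0 := by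
  rw [hat_eq_hat_iff hw (mul_mem (refl_mem_weyl hα) hw), isom_mul_apply]
  constructor
  · rintro ⟨a, ha, h⟩
    rw [← inner_refl_eq_inner_iff (ne_zero_of_mem_roots hα), h, inner_map_dominantVector ha]
  · rintro (h | h)
    · exact ⟨refl α, (refl_mem_parabolic_iff hα).2 h, rfl⟩
    · exact ⟨1, one_mem _, refl_eq_self_iff.2 h⟩

theorem bruhatLE_refl_mul_iff_inner_pos {w : Isom n} (hw : w ∈ weyl n) {α : Space n}
    (hα : α ∈ posRoots n) (h : ⟪α, w (dominantVector P)⟫ ≠ 0) :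
    BruhatLE w (refl α * w) ↔ 0 < ⟪α, w (dominantVector P)⟫ := by
  rw [bruhatLE_refl_mul_iff hw hα]
  rw [inner_map_right] at h ⊢
  exact ⟨fun h' => (inner_dominantVector_nonneg P h').lt_of_ne' h,
    mem_posRoots_of_inner_dominantVector_pos (map_mem_roots (inv_mem hw) hα.1)⟩

theorem mem_edges_parabolicGraph {s : Isom n × Space n × Isom n} :
    s ∈ (parabolicGraph P).edges ↔ ∃ w ∈ weyl n, ∃ α ∈ posRoots n,
      0 < ⟪α, w (dominantVector P)⟫ ∧ s = (bar P w, α, bar P (refl α * w)) := by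
  constructor
  · rintro ⟨w, hw, α, hα, hle, hne, rfl⟩
    rw [ne_comm, Ne, bar_refl_mul_eq_bar_iff hw.1 hα.1] at hne
    exact ⟨w, hw.1, α, hα, (bruhatLE_refl_mul_iff_inner_pos hw.1 hα hne).1 hle,
      by rw [bar_eq_self hw]⟩
  · rintro ⟨w, hw, α, hα, hpos, rfl⟩
    have hbar := bar_mem_minLeft (P := P) hw
    rw [← bar_dominantVector hw] at hpos
    refine ⟨bar P w, hbar, α, hα, (bruhatLE_refl_mul_iff_inner_pos hbar.1 hα hpos.ne').2 hpos,
      ?_, by rw [bar_mul_bar (refl_mem_weyl hα.1) hw]⟩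
    rw [ne_comm, Ne, bar_refl_mul_eq_bar_iff hbar.1 hα.1]
    exact hpos.ne'

theorem ne_and_isPossibleLabel_iff {u u' : Isom n} (hu : u ∈ minDouble Q P) {β : Space n} :
    u ≠ u' ∧ IsPossibleLabel Q P u u' β ↔ β ∈ posRoots n ∧ 0 < ⟪β, dominantVector Q⟫ ∧
      0 < ⟪β, u (dominantVector P)⟫ ∧ u' = hat Q P (refl β * u) := by
  have hne (hβ : β ∈ posRoots n) : u ≠ hat Q P (refl β * u) ↔
      ⟪β, dominantVector Q⟫ ≠ 0 ∧ ⟪β, u (dominantVector P)⟫ ≠ 0 := by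
    have := hat_refl_mul_eq_hat_iff (Q := Q) (P := P) hu.1 hβ.1
    rw [hat_eq_self hu] at this
    rw [ne_comm, Ne, this, not_or]
  constructor
  · rintro ⟨h, hβ, rfl, hle⟩
    obtain ⟨hQ, hP⟩ := (hne hβ).1 h
    exact ⟨hβ, (inner_dominantVector_nonneg Q hβ).lt_of_ne' hQ,
      (bruhatLE_refl_mul_iff_inner_pos hu.1 hβ hP).1 hle, rfl⟩
  · rintro ⟨hβ, hQ, hP, rfl⟩
    exact ⟨(hne hβ).2 ⟨hQ.ne', hP.ne'⟩, hβ, rfl,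
      (bruhatLE_refl_mul_iff_inner_pos hu.1 hβ hP.ne').2 hP⟩

namespace DoubleMomentGraph

variable (D : DoubleMomentGraph Q P)

theorem label_spec (t : doubleEdges Q P) : D.label t ∈ posRoots n ∧
    0 < ⟪D.label t, dominantVector Q⟫ ∧ 0 < ⟪D.label t, t.1.1 (dominantVector P)⟫ ∧
      t.1.2 = hat Q P (refl (D.label t) * t.1.1) :=
  (ne_and_isPossibleLabel_iff t.2.1).1 ⟨t.2.2.1, D.isPossibleLabel_label t⟩

theorem fst_mem_weyl (t : doubleEdges Q P) : t.1.1 ∈ weyl n := t.2.1.1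

theorem refl_label_mul_mem_weyl (t : doubleEdges Q P) : refl (D.label t) * t.1.1 ∈ weyl n :=
  mul_mem (refl_mem_weyl (D.label_spec t).1.1) (fst_mem_weyl t)

theorem mem_weyl_of_mem_verts {x : Isom n} (hx : x ∈ D.toParabolic.verts) : x ∈ weyl n := by
  rcases hx with hx | ⟨t, rfl⟩
  · exact hx.1
  · exact (bar_mem_minLeft (D.refl_label_mul_mem_weyl t)).1

theorem verts_closureGraph : (closureGraph Q P D.toParabolic).verts = minLeft P := by
  ext y
  constructor
  · rintro ⟨a, ha, x, hx, rfl⟩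
    exact bar_mem_minLeft (mul_mem (parabolic_le_weyl Q ha) (D.mem_weyl_of_mem_verts hx))
  · intro hy
    obtain ⟨a, ha, h⟩ := exists_map_hat_dominantVector Q P hy.1
    have hu := hat_mem_minDouble (Q := Q) (P := P) hy.1
    refine ⟨a, ha, _, Or.inl hu, ?_⟩
    rw [← (bar_eq_bar_iff (mul_mem (parabolic_le_weyl Q ha) hu.1) hy.1).2 h.symm, bar_eq_self hy]

/-- The third family of edges of the closure is empty: `W_Q` fixes `dominantVector Q`, so it keeps
the labels of a double moment graph positive. -/
theorem mem_edges_closureGraph {s : Isom n × Space n × Isom n} :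
    s ∈ (closureGraph Q P D.toParabolic).edges ↔
      (s ∈ (parabolicGraph P).edges ∧ ∃ x ∈ D.toParabolic.verts, ∃ a ∈ parabolic Q,
        ∃ b ∈ parabolic Q, s.1 = bar P (a * x) ∧ s.2.2 = bar P (b * x)) ∨
      ∃ t, ∃ a ∈ parabolic Q, s = (bar P (a * t.1.1), a (D.label t),
        bar P (refl (a (D.label t)) * (a * t.1.1))) := by
  have htgt {t : doubleEdges Q P} {a : Isom n} (ha : a ∈ parabolic Q) :
      bar P (a * bar P (refl (D.label t) * t.1.1)) =
        bar P (refl (a (D.label t)) * (a * t.1.1)) := by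
    rw [bar_mul_bar (parabolic_le_weyl Q ha) (D.refl_label_mul_mem_weyl t), ← mul_assoc, mul_refl,
      mul_assoc]
  have hpos {t : doubleEdges Q P} {a : Isom n} (ha : a ∈ parabolic Q) :
      0 < ⟪a (D.label t), dominantVector Q⟫ := by
    rw [inner_map_dominantVector ha]
    exact (D.label_spec t).2.1
  constructor
  · rintro ((h | ⟨x, α, y, ⟨t, ht⟩, a, ha, -, rfl⟩) | ⟨x, α, y, ⟨t, ht⟩, a, ha, hneg, -⟩)
    · exact Or.inl h
    · obtain ⟨rfl, rfl, rfl⟩ := ht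
      exact Or.inr ⟨t, a, ha, by rw [htgt ha]⟩
    · obtain ⟨rfl, rfl, rfl⟩ := ht
      have := inner_dominantVector_nonneg Q hneg
      rw [inner_neg_left] at this
      linarith [hpos (t := t) ha]
  · rintro (h | ⟨t, a, ha, rfl⟩)
    · exact Or.inl (Or.inl h)
    · exact Or.inl (Or.inr ⟨_, _, _, ⟨t, rfl⟩, a, ha, mem_posRoots_of_inner_dominantVector_pos
        (map_mem_roots (parabolic_le_weyl Q ha) (D.label_spec t).1.1) (hpos ha),
        by rw [htgt ha]⟩)

theorem edges_closureGraph_subset :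
    (closureGraph Q P D.toParabolic).edges ⊆ (parabolicGraph P).edges := by
  intro s hs
  rcases D.mem_edges_closureGraph.1 hs with h | ⟨t, a, ha, rfl⟩
  · exact h.1
  · obtain ⟨hβ, hQ, hP, -⟩ := D.label_spec t
    have haW := parabolic_le_weyl Q ha
    refine mem_edges_parabolicGraph.2 ⟨a * t.1.1, mul_mem haW (fst_mem_weyl t), a (D.label t),
      mem_posRoots_of_inner_dominantVector_pos (P := Q) (map_mem_roots haW hβ.1) ?_, ?_, rfl⟩
    · rwa [inner_map_dominantVector ha]
    · rwa [isom_mul_apply, LinearIsometryEquiv.inner_map_map]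

theorem mem_edges_closureGraph_iff {w : Isom n} (hw : w ∈ weyl n) {α : Space n}
    (hα : α ∈ posRoots n) (hP : 0 < ⟪α, w (dominantVector P)⟫) :
    (bar P w, α, bar P (refl α * w)) ∈ (closureGraph Q P D.toParabolic).edges ↔
      ⟪α, dominantVector Q⟫ = 0 ∨ ∃ t, ∃ a ∈ parabolic Q,
        a (t.1.1 (dominantVector P)) = w (dominantVector P) ∧ a (D.label t) = α := by
  have hsw := mul_mem (refl_mem_weyl hα.1) hw
  rw [mem_edges_closureGraph]
  refine or_congr ⟨fun ⟨_, x, hx, a, ha, b, hb, hxw, hxsw⟩ => ?_, fun hQ => ?_⟩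
    (exists_congr fun t => ⟨fun ⟨a, ha, h⟩ => ?_, fun ⟨a, ha, h, hα'⟩ => ?_⟩)
  · have hxW := D.mem_weyl_of_mem_verts hx
    rw [bar_eq_bar_iff (mul_mem (parabolic_le_weyl Q ha) hxW) hw, isom_mul_apply] at hxw
    rw [bar_eq_bar_iff (mul_mem (parabolic_le_weyl Q hb) hxW) hsw, isom_mul_apply b x] at hxsw
    refine ((hat_refl_mul_eq_hat_iff (Q := Q) hw hα.1).1 ?_).resolve_right hP.ne'
    refine (hat_eq_hat_iff hw hsw).2 ⟨b * a⁻¹, mul_mem hb (inv_mem ha), ?_⟩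
    rw [hxsw, hxw, isom_mul_apply, inv_apply_self]
  · obtain ⟨a, ha, h⟩ := exists_map_hat_dominantVector Q P hw
    have hu := hat_mem_minDouble (Q := Q) (P := P) hw
    have hra := mul_mem ((refl_mem_parabolic_iff hα.1).2 hQ) ha
    refine ⟨mem_edges_parabolicGraph.2 ⟨w, hw, α, hα, hP, rfl⟩, _, Or.inl hu, a, ha,
      refl α * a, hra, ?_, ?_⟩
    · exact (bar_eq_bar_iff (mul_mem (parabolic_le_weyl Q ha) hu.1) hw).2 h.symm
    · exact (bar_eq_bar_iff (mul_mem (parabolic_le_weyl Q hra) hu.1) hsw).2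
        (congrArg (refl α) h.symm)
  · simp only [Prod.mk.injEq] at h
    rw [bar_eq_bar_iff (mul_mem (parabolic_le_weyl Q ha) (fst_mem_weyl t)) hw] at h
    exact ⟨a, ha, h.1.symm, h.2.1.symm⟩
  · have haW := mul_mem (parabolic_le_weyl Q ha) (fst_mem_weyl t)
    refine ⟨a, ha, ?_⟩
    rw [hα', (bar_eq_bar_iff haW hw).2 h.symm, (bar_eq_bar_iff
      (mul_mem (refl_mem_weyl hα.1) haW) hsw).2 (congrArg (refl α) h.symm)]

theorem isClosed_iff_forall_exists_translate :
    D.IsClosed ↔ ∀ w ∈ weyl n, ∀ α ∈ roots n, 0 < ⟪α, dominantVector Q⟫ →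
      0 < ⟪α, w (dominantVector P)⟫ → ∃ t, ∃ a ∈ parabolic Q,
        a (t.1.1 (dominantVector P)) = w (dominantVector P) ∧ a (D.label t) = α := by
  constructor
  · intro h w hw α hα hQ hP
    have hα' := mem_posRoots_of_inner_dominantVector_pos hα hQ
    have hedge := mem_edges_parabolicGraph.2 ⟨w, hw, α, hα', hP, rfl⟩
    rw [← h] at hedge
    exact ((D.mem_edges_closureGraph_iff hw hα' hP).1 hedge).resolve_left hQ.ne'
  · intro h
    refine MomentGraph.ext D.verts_closureGraph
      (D.edges_closureGraph_subset.antisymm fun s hs => ?_)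
    obtain ⟨w, hw, α, hα, hP, rfl⟩ := mem_edges_parabolicGraph.1 hs
    rw [D.mem_edges_closureGraph_iff hw hα hP]
    exact (inner_dominantVector_nonneg Q hα).eq_or_lt.imp Eq.symm fun hQ => h w hw α hα.1 hQ hP

end DoubleMomentGraph

/-- The positive reflections that move `y` into one and the same orbit of the stabilizer of `x`
are conjugate under the common stabilizer of `x` and `y`; here a reflection is called positive if
its root pairs positively with both `x` and `y`. For `x = dominantVector Q` and
`y = u (dominantVector P)` they are the edges of the parabolic moment graph from the vertex
`bar P u` into a given `W_Q`-orbit other than its own. -/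
def SingleOrbit (x y : Space n) : Prop :=
  ∀ α ∈ roots n, ∀ α' ∈ roots n, 0 < ⟪α, x⟫ → 0 < ⟪α, y⟫ → 0 < ⟪α', x⟫ → 0 < ⟪α', y⟫ →
    (∃ w ∈ weyl n, w x = x ∧ w (refl α y) = refl α' y) →
    ∃ w ∈ weyl n, w x = x ∧ w y = y ∧ w α = α'

theorem SingleOrbit.symm {x y : Space n} (h : SingleOrbit x y) : SingleOrbit y x := by
  rintro α hα α' hα' hαy hαx hα'y hα'x ⟨w, hw, hwy, hwx⟩
  have connecting : ∃ w ∈ weyl n, w x = x ∧ w (refl α y) = refl α' y := by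
    refine ⟨refl α' * w * refl α, mul_mem (mul_mem (refl_mem_weyl hα') hw) (refl_mem_weyl hα),
      ?_, ?_⟩
    · rw [isom_mul_apply, isom_mul_apply, hwx, refl_refl_apply]
    · rw [isom_mul_apply, isom_mul_apply, refl_refl_apply, hwy]
  obtain ⟨v, hv, hvx, hvy, hvα⟩ := h α hα α' hα' hαx hαy hα'x hα'y connecting
  exact ⟨v, hv, hvy, hvx, hvα⟩

namespace DoubleMomentGraph

variable {D : DoubleMomentGraph Q P}

theorem IsClosed.singleOrbit (h : D.IsClosed) {u : Isom n} (hu : u ∈ weyl n) :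
    SingleOrbit (dominantVector Q) (u (dominantVector P)) := by
  rw [isClosed_iff_forall_exists_translate] at h
  rintro α hα α' hα' hαQ hαP hα'Q hα'P ⟨w, hw, hwQ, hwα⟩
  obtain ⟨t, a, ha, hat, rfl⟩ := h u hu α hα hαQ hαP
  obtain ⟨t', a', ha', hat', rfl⟩ := h u hu α' hα' hα'Q hα'P
  have hfst : t'.1.1 = t.1.1 := by
    rw [← hat_eq_self t.2.1, ← hat_eq_self t'.2.1, hat_eq_hat_iff (fst_mem_weyl t)
      (fst_mem_weyl t')]
    exact ⟨a'⁻¹ * a, mul_mem (inv_mem ha') ha, by rw [isom_mul_apply, hat, ← hat', inv_apply_self]⟩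
  have hsnd : t'.1.2 = t.1.2 := by
    rw [(D.label_spec t).2.2.2, (D.label_spec t').2.2.2, hat_eq_hat_iff
      (D.refl_label_mul_mem_weyl t) (D.refl_label_mul_mem_weyl t')]
    refine ⟨a'⁻¹ * (w * a), mul_mem (inv_mem ha')
      (mul_mem (mem_parabolic_iff.2 ⟨hw, hwQ⟩) ha), ?_⟩
    rw [isom_mul_apply, isom_mul_apply, isom_mul_apply, isom_mul_apply, map_refl a, hat, hwα,
      ← hat', ← map_refl, inv_apply_self]
  obtain rfl : t' = t := Subtype.ext (Prod.ext hfst hsnd)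
  have hmem : a' * a⁻¹ ∈ parabolic Q := mul_mem ha' (inv_mem ha)
  refine ⟨a' * a⁻¹, parabolic_le_weyl Q hmem, map_dominantVector hmem, ?_, ?_⟩
  · rw [isom_mul_apply, ← hat, inv_apply_self, hat', hat]
  · rw [isom_mul_apply, inv_apply_self]

theorem isClosed_of_singleOrbit
    (h : ∀ u ∈ weyl n, SingleOrbit (dominantVector Q) (u (dominantVector P))) : D.IsClosed := by
  rw [isClosed_iff_forall_exists_translate]
  intro w hw α hα hQ hP
  obtain ⟨a, ha, hau⟩ := exists_map_hat_dominantVector Q P hw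
  have hu := hat_mem_minDouble (Q := Q) (P := P) hw
  set u := hat Q P w
  obtain ⟨γ, rfl⟩ : ∃ γ, a γ = α := ⟨a⁻¹ α, apply_inv_self a α⟩
  rw [inner_map_dominantVector ha] at hQ
  rw [← hau, LinearIsometryEquiv.inner_map_map] at hP
  have hγ : γ ∈ posRoots n := mem_posRoots_of_inner_dominantVector_pos (by
    simpa only [inv_apply_self] using map_mem_roots (inv_mem (parabolic_le_weyl Q ha)) hα) hQ
  have hlabel := (ne_and_isPossibleLabel_iff hu).2 ⟨hγ, hQ, hP, rfl⟩
  let t : doubleEdges Q P := ⟨(u, hat Q P (refl γ * u)), hu, hlabel.1, γ, hlabel.2⟩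
  obtain ⟨hβ, hβQ, hβP, hsnd⟩ := D.label_spec t
  obtain ⟨c, hc, hcβ⟩ := (hat_eq_hat_iff (D.refl_label_mul_mem_weyl t)
    (mul_mem (refl_mem_weyl hγ.1) hu.1)).1 hsnd
  obtain ⟨v, hv, hvQ, hvu, hvβ⟩ := h u hu.1 _ hβ.1 γ hγ.1 hβQ hβP hQ hP
    ⟨c, parabolic_le_weyl Q hc, map_dominantVector hc, hcβ.symm⟩
  refine ⟨t, a * v, mul_mem ha (mem_parabolic_iff.2 ⟨hv, hvQ⟩), ?_, ?_⟩
  · rw [isom_mul_apply, hvu, hau]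
  · rw [isom_mul_apply, hvβ]

theorem isClosed_iff_forall_singleOrbit :
    D.IsClosed ↔ ∀ u ∈ weyl n, SingleOrbit (dominantVector Q) (u (dominantVector P)) :=
  ⟨fun h _ => h.singleOrbit, isClosed_of_singleOrbit⟩

end DoubleMomentGraph

end Closedness

/-! ### Pairs of coordinates up to sign -/

section PlusMinus

/-- The multiset `{z, -z}`; it stands for a pair of coordinates up to a simultaneous sign. -/
def plusMinus (z : ℝ × ℝ) : Multiset (ℝ × ℝ) := {z, -z}

theorem mem_plusMinus {z p : ℝ × ℝ} : p ∈ plusMinus z ↔ p = z ∨ p = -z := by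
  rw [plusMinus, Multiset.insert_eq_cons, Multiset.mem_cons, Multiset.mem_singleton]

theorem card_plusMinus (z : ℝ × ℝ) : Multiset.card (plusMinus z) = 2 := rfl

theorem plusMinus_neg (z : ℝ × ℝ) : plusMinus (-z) = plusMinus z := by
  rw [plusMinus, plusMinus, neg_neg, Multiset.pair_comm]

theorem plusMinus_eq_iff {z z' : ℝ × ℝ} : plusMinus z = plusMinus z' ↔ z = z' ∨ z = -z' := by
  refine ⟨fun h => mem_plusMinus.1 (h ▸ mem_plusMinus.2 (Or.inl rfl)), ?_⟩
  rintro (rfl | rfl)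
  · rfl
  · exact plusMinus_neg z'

theorem plusMinus_add_eq_iff {a b a' b' : ℝ × ℝ} :
    plusMinus a + plusMinus b = plusMinus a' + plusMinus b' ↔
      (a = a' ∨ a = -a') ∧ (b = b' ∨ b = -b') ∨ (a = b' ∨ a = -b') ∧ (b = a' ∨ b = -a') := by
  simp only [← plusMinus_eq_iff]
  constructor
  · intro h
    have ha : a ∈ plusMinus a' + plusMinus b' :=
      h ▸ Multiset.mem_add.2 (Or.inl (mem_plusMinus.2 (Or.inl rfl)))
    rw [Multiset.mem_add, mem_plusMinus, mem_plusMinus, ← plusMinus_eq_iff,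
      ← plusMinus_eq_iff] at ha
    refine ha.imp (fun ha => ⟨ha, ?_⟩) (fun ha => ⟨ha, ?_⟩)
    · rwa [ha, add_right_inj] at h
    · rwa [ha, add_comm (plusMinus a'), add_right_inj] at h
  · rintro (⟨ha, hb⟩ | ⟨ha, hb⟩)
    · rw [ha, hb]
    · rw [ha, hb, add_comm]

/-- If `a` and `b` are the coordinates of `(x, y)` along `u` and `v`, then `(a.1, -b.2)` and
`(b.1, -a.2)` are those of `(x, refl (u + v) y)`, and the positivity hypotheses say that `u + v`
pairs positively with `x` and `y`. -/
theorem eq_or_eq_swap_of_plusMinus_add_eq {a b a' b' : ℝ × ℝ} (hab₁ : 0 < a.1 + b.1)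
    (hab₂ : 0 < a.2 + b.2) (hab₁' : 0 < a'.1 + b'.1) (hab₂' : 0 < a'.2 + b'.2)
    (h : plusMinus a + plusMinus b = plusMinus a' + plusMinus b')
    (hrefl : plusMinus (a.1, -b.2) + plusMinus (b.1, -a.2) =
      plusMinus (a'.1, -b'.2) + plusMinus (b'.1, -a'.2)) :
    a = a' ∧ b = b' ∨ a = b' ∧ b = a' := by
  rw [plusMinus_add_eq_iff] at h hrefl
  simp only [Prod.ext_iff, Prod.fst_neg, Prod.snd_neg] at h hrefl ⊢
  grind

theorem eq_of_plusMinus_eq {a a' : ℝ × ℝ} (ha : 0 < a.1) (ha' : 0 < a'.1)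
    (h : plusMinus a = plusMinus a') : a = a' := by
  refine (plusMinus_eq_iff.1 h).resolve_right ?_
  rintro rfl
  exact lt_asymm ha' (neg_pos.1 ha)

theorem disjoint_plusMinus {a : ℝ × ℝ} (h₁ : 0 < a.1) (h₂ : 0 < a.2) :
    Disjoint (plusMinus a) (plusMinus (a.1, -a.2)) := by
  rw [Multiset.disjoint_left]
  simp only [mem_plusMinus, Prod.ext_iff, Prod.fst_neg, Prod.snd_neg]
  grind

theorem disjoint_plusMinus_add {a b : ℝ × ℝ} (h₁ : 0 < a.1 + b.1) (h₂ : 0 < a.2 + b.2)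
    (hfst : a.2 = b.2 → a.2 ≠ 0 → (a.1 = 0 ↔ b.1 = 0))
    (hsnd : a.1 = b.1 → a.1 ≠ 0 → (a.2 = 0 ↔ b.2 = 0)) :
    Disjoint (plusMinus a + plusMinus b) (plusMinus (a.1, -b.2) + plusMinus (b.1, -a.2)) := by
  rw [Multiset.disjoint_left]
  simp only [Multiset.mem_add, mem_plusMinus, Prod.ext_iff, Prod.fst_neg, Prod.snd_neg]
  grind

theorem eq_sub_of_add_eq_add_of_disjoint {ι : Type*} [DecidableEq ι] {V V' R A : Multiset ι}
    (h : V' + R = V + A) (hRA : Disjoint R A) : R = V - V' := by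
  ext p
  have hcount := congrArg (Multiset.count p) h
  have : Multiset.count p R = 0 ∨ Multiset.count p A = 0 := by
    rw [Multiset.count_eq_zero, Multiset.count_eq_zero, ← not_and_or]
    exact fun hp => Multiset.disjoint_left.1 hRA hp.1 hp.2
  rw [Multiset.count_add, Multiset.count_add] at hcount
  rw [Multiset.count_sub]
  omega

end PlusMinus

/-! ### Orbits of reflections for a pair of vectors -/

section Orbits

variable {n : ℕ} {x y u v : Space n}

/-- The pairs of coordinates of `(x, y)` along all vectors `±e_i`. They depend only on the orbit of
`(x, y)` under the Weyl group. -/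
def coordPairs (x y : Space n) : Multiset (ℝ × ℝ) :=
  ∑ b ∈ (finite_signedBasis n).toFinset, {(⟪b, x⟫, ⟪b, y⟫)}

open Classical in
/-- The part of `coordPairs x y` that comes from the vectors `±e_i` moved by `refl α`. -/
def movedPairs (α x y : Space n) : Multiset (ℝ × ℝ) :=
  ∑ b ∈ (finite_signedBasis n).toFinset with ⟪α, b⟫ ≠ 0, {(⟪b, x⟫, ⟪b, y⟫)}

theorem coordPairs_map {w : Isom n} (hw : w ∈ weyl n) (x y : Space n) :
    coordPairs (w x) (w y) = coordPairs x y := by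
  have hmaps {g : Isom n} (hg : g ∈ weyl n) (b) (hb : b ∈ (finite_signedBasis n).toFinset) :
      g b ∈ (finite_signedBasis n).toFinset := by
    rw [Set.Finite.mem_toFinset] at hb ⊢
    exact mapsTo_signedBasis hg hb
  refine Finset.sum_nbij' (w⁻¹ ·) (w ·) (hmaps (inv_mem hw)) (hmaps hw)
    (fun b _ => apply_inv_self w b) (fun b _ => inv_apply_self w b) fun b _ => ?_
  rw [inner_map_right, inner_map_right]

theorem coordPairs_refl_add_movedPairs (α x y : Space n) :
    coordPairs x (refl α y) + movedPairs α x y =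
      coordPairs x y + movedPairs α x (refl α y) := by
  classical
  have hsplit (z : Space n) := Finset.sum_filter_add_sum_filter_not
    (finite_signedBasis n).toFinset (⟪α, ·⟫ ≠ 0) fun b => ({(⟪b, x⟫, ⟪b, z⟫)} : Multiset (ℝ × ℝ))
  have hfixed (b : Space n) (hb : ¬⟪α, b⟫ ≠ 0) : ⟪b, refl α y⟫ = ⟪b, y⟫ := by
    rw [← inner_refl_left, refl_eq_self_iff.2 (not_not.1 hb)]
  rw [coordPairs, coordPairs, movedPairs, movedPairs, ← hsplit y, ← hsplit (refl α y),
    Finset.sum_congr (s₁ := Finset.filter (¬⟪α, ·⟫ ≠ 0) _) rfl fun b hb => by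
      rw [hfixed b (Finset.mem_filter.1 hb).2]]
  abel

theorem movedPairs_add (hu : u ∈ signedBasis n) (hv : v ∈ signedBasis n) (huv : ⟪u, v⟫ = 0)
    (x y : Space n) :
    movedPairs (u + v) x y = plusMinus (⟪u, x⟫, ⟪u, y⟫) + plusMinus (⟪v, x⟫, ⟪v, y⟫) := by
  classical
  have hvu : ⟪v, u⟫ = 0 := real_inner_comm u v ▸ huv
  have huu := inner_self_signedBasis hu
  have hvv := inner_self_signedBasis hv
  have hmoved : {b ∈ (finite_signedBasis n).toFinset | ⟪u + v, b⟫ ≠ 0} = {u, -u, v, -v} := by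
    ext b
    simp only [Finset.mem_filter, Set.Finite.mem_toFinset, Finset.mem_insert, Finset.mem_singleton]
    constructor
    · rintro ⟨hb, hne⟩
      by_contra! h
      have hbu := ((signedBasis_cases hb hu).resolve_left h.1).resolve_left h.2.1
      have hbv := ((signedBasis_cases hb hv).resolve_left h.2.2.1).resolve_left h.2.2.2
      rw [inner_add_left, real_inner_comm, hbu, real_inner_comm, hbv, add_zero] at hne
      exact hne rfl
    · rintro (rfl | rfl | rfl | rfl) <;>
        simp only [inner_add_left, inner_neg_right, hu, hv, neg_mem_signedBasis, huu, hvv, huv,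
          hvu, true_and] <;> norm_num
  have hne : u ≠ v ∧ u ≠ -v := by
    constructor <;> rintro rfl <;> simp_all
  have hu' := ne_neg_self_of_mem_signedBasis hu
  have hv' := ne_neg_self_of_mem_signedBasis hv
  rw [movedPairs, hmoved, Finset.sum_insert, Finset.sum_insert, Finset.sum_pair hv']
  · simp only [plusMinus, inner_neg_left, Prod.neg_mk, Multiset.insert_eq_cons,
      ← Multiset.singleton_add]
    abel
  · simp [hne.1, hne.2, neg_eq_iff_eq_neg]
  · simp [hne.1, hne.2, hu']

theorem movedPairs_add_self (hu : u ∈ signedBasis n) (x y : Space n) :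
    movedPairs (u + u) x y = plusMinus (⟪u, x⟫, ⟪u, y⟫) := by
  classical
  have huu := inner_self_signedBasis hu
  have hmoved : {b ∈ (finite_signedBasis n).toFinset | ⟪u + u, b⟫ ≠ 0} = {u, -u} := by
    ext b
    simp only [Finset.mem_filter, Set.Finite.mem_toFinset, Finset.mem_insert, Finset.mem_singleton]
    constructor
    · rintro ⟨hb, hne⟩
      by_contra! h
      have hbu := ((signedBasis_cases hb hu).resolve_left h.1).resolve_left h.2
      rw [inner_add_left, real_inner_comm, hbu, add_zero] at hne
      exact hne rfl
    · rintro (rfl | rfl) <;>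
        simp only [inner_add_left, inner_neg_right, hu, neg_mem_signedBasis, huu, true_and] <;>
        norm_num
  rw [movedPairs, hmoved, Finset.sum_pair (ne_neg_self_of_mem_signedBasis hu)]
  simp only [plusMinus, inner_neg_left, Prod.neg_mk, Multiset.insert_eq_cons,
    Multiset.singleton_add]

theorem inner_refl_add_right (hu : u ∈ signedBasis n) (hv : v ∈ signedBasis n) (huv : u ≠ -v)
    (y : Space n) : ⟪u, refl (u + v) y⟫ = -⟪v, y⟫ := by
  rw [← inner_refl_left, refl_add_left hu hv huv, inner_neg_left]

/-- On the vectors `±e_i` along which `y` takes a given nonzero value, `x` vanishes everywhere or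
nowhere. -/
def UniformlyVanishing (x y : Space n) : Prop :=
  ∀ u ∈ signedBasis n, ∀ v ∈ signedBasis n,
    ⟪u, y⟫ = ⟪v, y⟫ → ⟪u, y⟫ ≠ 0 → (⟪u, x⟫ = 0 ↔ ⟪v, x⟫ = 0)

theorem exists_map_eq (hu : u ∈ signedBasis n) (hv : v ∈ signedBasis n) :
    ∃ w ∈ weyl n, w u = v ∧ ∀ z, ⟪u, z⟫ = ⟪v, z⟫ → w z = z := by
  by_cases huv : u = v
  · exact ⟨1, one_mem _, huv, fun _ _ => rfl⟩
  · refine ⟨refl (u - v), refl_mem_weyl (sub_mem_roots hu hv huv), refl_sub_left hu hv huv,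
      fun z hz => ?_⟩
    rw [refl_eq_self_iff, inner_sub_left, hz, sub_self]

theorem exists_map_eq_map_eq {u' v' : Space n} (hu : u ∈ signedBasis n) (hv : v ∈ signedBasis n)
    (hu' : u' ∈ signedBasis n) (hv' : v' ∈ signedBasis n) (huv : ⟪u, v⟫ = 0)
    (huv' : ⟪u', v'⟫ = 0) :
    ∃ w ∈ weyl n, w u = u' ∧ w v = v' ∧ ∀ z, ⟪u, z⟫ = ⟪u', z⟫ → ⟪v, z⟫ = ⟪v', z⟫ → w z = z := by
  obtain ⟨g, hg, hgu, hgz⟩ := exists_map_eq hu hu'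
  obtain ⟨h, hh, hhv, hhz⟩ := exists_map_eq (mapsTo_signedBasis hg hv) hv'
  refine ⟨h * g, mul_mem hh hg, ?_, hhv, fun z hzu hzv => ?_⟩
  · have hgv : ⟪g v, u'⟫ = 0 := by
      rw [← hgu, LinearIsometryEquiv.inner_map_map, real_inner_comm, huv]
    rw [isom_mul_apply, hgu, hhz u' (by rw [hgv, real_inner_comm, huv'])]
  · have hgvz : ⟪g v, z⟫ = ⟪v, z⟫ := by
      rw [inner_map_left, inv_apply_eq.2 (hgz z hzu).symm]
    rw [isom_mul_apply, hgz z hzu, hhz z (by rw [hgvz, hzv])]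

theorem eq_add_self_or_eq_add_of_mem_roots {α : Space n} (hα : α ∈ roots n) :
    (∃ u ∈ signedBasis n, α = u + u) ∨
      ∃ u ∈ signedBasis n, ∃ v ∈ signedBasis n, ⟪u, v⟫ = 0 ∧ α = u + v := by
  obtain ⟨u, hu, v, hv, huv, rfl⟩ := exists_eq_add_of_mem_roots hα
  rcases signedBasis_cases hu hv with rfl | h | h
  · exact Or.inl ⟨u, hu, rfl⟩
  · exact absurd h huv
  · exact Or.inr ⟨u, hu, v, hv, h, rfl⟩

theorem movedPairs_add_refl (hu : u ∈ signedBasis n) (hv : v ∈ signedBasis n) (huv : ⟪u, v⟫ = 0)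
    (x y : Space n) :
    movedPairs (u + v) x (refl (u + v) y) =
      plusMinus (⟪u, x⟫, -⟪v, y⟫) + plusMinus (⟪v, x⟫, -⟪u, y⟫) := by
  have huv' : u ≠ -v := by
    rintro rfl
    rw [inner_neg_left, inner_self_signedBasis hv] at huv
    norm_num at huv
  have hvu' : v ≠ -u := fun h => huv' (neg_eq_iff_eq_neg.1 h.symm)
  rw [movedPairs_add hu hv huv, inner_refl_add_right hu hv huv', add_comm u v,
    inner_refl_add_right hv hu hvu']

theorem disjoint_movedPairs (hxy : UniformlyVanishing x y) (hyx : UniformlyVanishing y x)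
    {α : Space n} (hα : α ∈ roots n) (hx : 0 < ⟪α, x⟫) (hy : 0 < ⟪α, y⟫) :
    Disjoint (movedPairs α x y) (movedPairs α x (refl α y)) := by
  rcases eq_add_self_or_eq_add_of_mem_roots hα with ⟨u, hu, rfl⟩ | ⟨u, hu, v, hv, huv, rfl⟩ <;>
    rw [inner_add_left] at hx hy
  · rw [movedPairs_add_self hu, movedPairs_add_self hu,
      inner_refl_add_right hu hu (ne_neg_self_of_mem_signedBasis hu)]
    exact disjoint_plusMinus (pos_add_self_iff.1 hx) (pos_add_self_iff.1 hy)
  · rw [movedPairs_add hu hv huv, movedPairs_add_refl hu hv huv]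
    exact disjoint_plusMinus_add hx hy (hxy u hu v hv) (hyx u hu v hv)

theorem exists_map_eq_of_movedPairs_eq {α α' : Space n} (hα : α ∈ roots n) (hα' : α' ∈ roots n)
    (hx : 0 < ⟪α, x⟫) (hy : 0 < ⟪α, y⟫) (hx' : 0 < ⟪α', x⟫) (hy' : 0 < ⟪α', y⟫)
    (hmoved : movedPairs α x y = movedPairs α' x y)
    (hrefl : movedPairs α x (refl α y) = movedPairs α' x (refl α' y)) :
    ∃ w ∈ weyl n, w x = x ∧ w y = y ∧ w α = α' := by
  have hcard := congrArg Multiset.card hmoved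
  rcases eq_add_self_or_eq_add_of_mem_roots hα with ⟨u, hu, rfl⟩ | ⟨u, hu, v, hv, huv, rfl⟩ <;>
  rcases eq_add_self_or_eq_add_of_mem_roots hα' with
    ⟨u', hu', rfl⟩ | ⟨u', hu', v', hv', huv', rfl⟩ <;>
  rw [inner_add_left] at hx hy hx' hy'
  · rw [movedPairs_add_self hu, movedPairs_add_self hu'] at hmoved
    obtain ⟨hux, huy⟩ := Prod.ext_iff.1
      (eq_of_plusMinus_eq (pos_add_self_iff.1 hx) (pos_add_self_iff.1 hx') hmoved)
    obtain ⟨w, hw, hwu, hwz⟩ := exists_map_eq hu hu'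
    exact ⟨w, hw, hwz x hux, hwz y huy, by rw [map_add, hwu]⟩
  · rw [movedPairs_add_self hu, movedPairs_add hu' hv' huv', Multiset.card_add] at hcard
    simp only [card_plusMinus] at hcard
    omega
  · rw [movedPairs_add_self hu', movedPairs_add hu hv huv, Multiset.card_add] at hcard
    simp only [card_plusMinus] at hcard
    omega
  · rw [movedPairs_add hu hv huv, movedPairs_add hu' hv' huv'] at hmoved
    rw [movedPairs_add_refl hu hv huv, movedPairs_add_refl hu' hv' huv'] at hrefl
    have hpairs := eq_or_eq_swap_of_plusMinus_add_eq hx hy hx' hy' hmoved hrefl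
    simp only [Prod.mk.injEq] at hpairs
    rcases hpairs with ⟨⟨hux, huy⟩, hvx, hvy⟩ | ⟨⟨hux, huy⟩, hvx, hvy⟩
    · obtain ⟨w, hw, hwu, hwv, hwz⟩ := exists_map_eq_map_eq hu hv hu' hv' huv huv'
      exact ⟨w, hw, hwz x hux hvx, hwz y huy hvy, by rw [map_add, hwu, hwv]⟩
    · obtain ⟨w, hw, hwu, hwv, hwz⟩ :=
        exists_map_eq_map_eq hu hv hv' hu' huv (real_inner_comm u' v' ▸ huv')
      exact ⟨w, hw, hwz x hux hvx, hwz y huy hvy, by rw [map_add, hwu, hwv, add_comm]⟩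

theorem UniformlyVanishing.singleOrbit (hxy : UniformlyVanishing x y)
    (hyx : UniformlyVanishing y x) : SingleOrbit x y := by
  rintro α hα α' hα' hx hy hx' hy' ⟨w, hw, hwx, hwy⟩
  have hcoord : coordPairs x (refl α' y) = coordPairs x (refl α y) := by
    rw [← coordPairs_map hw x (refl α y), hwx, hwy]
  have hsum := coordPairs_refl_add_movedPairs α x y
  have hsum' := coordPairs_refl_add_movedPairs α' x y
  rw [hcoord] at hsum'
  have hmoved : movedPairs α x y = movedPairs α' x y := by
    rw [eq_sub_of_add_eq_add_of_disjoint hsum (disjoint_movedPairs hxy hyx hα hx hy),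
      eq_sub_of_add_eq_add_of_disjoint hsum' (disjoint_movedPairs hxy hyx hα' hx' hy')]
  have hrefl : movedPairs α x (refl α y) = movedPairs α' x (refl α' y) := by
    rw [hmoved] at hsum
    exact add_left_cancel (hsum.symm.trans hsum')
  exact exists_map_eq_of_movedPairs_eq hα hα' hx hy hx' hy' hmoved hrefl

theorem refl_add_self_refl_add (hu : u ∈ signedBasis n) (hv : v ∈ signedBasis n)
    (huv : ⟪u, v⟫ = 0) (hy : ⟪u, y⟫ = ⟪v, y⟫) :
    refl (u + u) (refl (u + v) y) = refl (v + v) y := by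
  simp only [refl_apply, inner_add_left, inner_add_right, inner_sub_right, inner_smul_right,
    inner_self_signedBasis hu, inner_self_signedBasis hv, huv, real_inner_comm u v ▸ huv, hy]
  module

/-- The short root `u + v` and the long root `v + v` give edges with the same end points modulo
the stabilizer of `x`, and no isometry takes one root to the other. -/
theorem not_singleOrbit_of_inner_eq (hu : u ∈ signedBasis n) (hv : v ∈ signedBasis n)
    (hy : 0 < ⟪u, y⟫) (huv : ⟪u, y⟫ = ⟪v, y⟫) (hux : ⟪u, x⟫ = 0) (hvx : 0 < ⟪v, x⟫) :
    ¬SingleOrbit x y := by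
  intro h
  have horth : ⟪u, v⟫ = 0 := by
    rcases signedBasis_cases hu hv with rfl | rfl | h₀
    · exact absurd hux hvx.ne'
    · rw [inner_neg_left, neg_eq_zero] at hux
      exact absurd hux hvx.ne'
    · exact h₀
  have huu := inner_self_signedBasis hu
  have hvv := inner_self_signedBasis hv
  have hshort : ⟪u + v, u + v⟫ = 2 := by
    rw [real_inner_add_add_self, huu, hvv, horth]
    norm_num
  have hlong : ⟪v + v, v + v⟫ = 4 := by
    rw [real_inner_add_add_self, hvv]
    norm_num
  have hne (b : Space n) (hb : b ∈ signedBasis n) := ne_neg_self_of_mem_signedBasis hb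
  have huv' : u ≠ -v := by
    rintro rfl
    rw [inner_neg_left, hvv] at horth
    norm_num at horth
  obtain ⟨w, -, -, -, hw⟩ := h (u + v) (add_mem_roots hu hv huv') (v + v)
    (add_mem_roots hv hv (hne v hv)) (by rw [inner_add_left, hux]; linarith)
    (by rw [inner_add_left]; linarith) (by rw [inner_add_left]; linarith)
    (by rw [inner_add_left]; linarith)
    ⟨refl (u + u), refl_mem_weyl (add_mem_roots hu hu (hne u hu)),
      refl_eq_self_iff.2 (by rw [inner_add_left, hux, add_zero]),
      refl_add_self_refl_add hu hv horth huv⟩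
  have := LinearIsometryEquiv.inner_map_map w (u + v) (u + v)
  rw [hw, hshort, hlong] at this
  norm_num at this

end Orbits

/-! ### The orbit criterion -/

section Criterion

variable {n : ℕ} {x y : Space n}

/-- Two different vectors `±e_i` have the same nonzero coordinate in `x`; for a dominant vector
this means a repeated nonzero coordinate. -/
def HasRepeat (x : Space n) : Prop :=
  ∃ u ∈ signedBasis n, ∃ v ∈ signedBasis n, u ≠ v ∧ ⟪u, x⟫ = ⟪v, x⟫ ∧ ⟪u, x⟫ ≠ 0

/-- `x` has both a zero and a nonzero coordinate. Ranging over `±e_i` rather than `e_i` makes the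
invariance under the Weyl group evident. -/
def IsMixed (x : Space n) : Prop :=
  (∃ u ∈ signedBasis n, ⟪u, x⟫ = 0) ∧ ∃ u ∈ signedBasis n, ⟪u, x⟫ ≠ 0

theorem HasRepeat.of_map {w : Isom n} (hw : w ∈ weyl n) (h : HasRepeat (w x)) : HasRepeat x := by
  obtain ⟨u, hu, v, hv, huv, heq, hne⟩ := h
  have hmaps := mapsTo_signedBasis (inv_mem hw)
  rw [inner_map_right, inner_map_right w] at heq
  rw [inner_map_right] at hne
  exact ⟨_, hmaps hu, _, hmaps hv, w⁻¹.injective.ne huv, heq, hne⟩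

theorem IsMixed.of_map {w : Isom n} (hw : w ∈ weyl n) (h : IsMixed (w x)) : IsMixed x := by
  obtain ⟨⟨u, hu, hux⟩, v, hv, hvx⟩ := h
  have hmaps := mapsTo_signedBasis (inv_mem hw)
  rw [inner_map_right] at hux hvx
  exact ⟨⟨_, hmaps hu, hux⟩, _, hmaps hv, hvx⟩

theorem HasRepeat.exists_pos (h : HasRepeat x) :
    ∃ u ∈ signedBasis n, ∃ v ∈ signedBasis n, ⟪u, v⟫ = 0 ∧ 0 < ⟪u, x⟫ ∧ ⟪u, x⟫ = ⟪v, x⟫ := by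
  obtain ⟨u, hu, v, hv, huv, heq, hne⟩ := h
  have horth : ⟪u, v⟫ = 0 := by
    rcases signedBasis_cases hu hv with h | rfl | h
    · exact absurd h huv
    · rw [inner_neg_left] at heq hne
      exact absurd (by linarith) hne
    · exact h
  rcases hne.lt_or_gt with hneg | hpos
  · refine ⟨-u, neg_mem_signedBasis hu, -v, neg_mem_signedBasis hv, ?_, ?_, ?_⟩
    · rw [inner_neg_neg, horth]
    · rwa [inner_neg_left, neg_pos]
    · rw [inner_neg_left, inner_neg_left, heq]
  · exact ⟨u, hu, v, hv, horth, hpos, heq⟩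

theorem IsMixed.exists_pos (h : IsMixed x) :
    ∃ u ∈ signedBasis n, ∃ v ∈ signedBasis n, ⟪u, v⟫ = 0 ∧ ⟪u, x⟫ = 0 ∧ 0 < ⟪v, x⟫ := by
  obtain ⟨⟨u, hu, hux⟩, v, hv, hvx⟩ := h
  have horth : ⟪u, v⟫ = 0 := by
    rcases signedBasis_cases hu hv with rfl | rfl | h
    · exact absurd hux hvx
    · rw [inner_neg_left, neg_eq_zero] at hux
      exact absurd hux hvx
    · exact h
  rcases hvx.lt_or_gt with hneg | hpos
  · refine ⟨u, hu, -v, neg_mem_signedBasis hv, ?_, hux, ?_⟩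
    · rw [inner_neg_right, horth, neg_zero]
    · rwa [inner_neg_left, neg_pos]
  · exact ⟨u, hu, v, hv, horth, hux, hpos⟩

theorem uniformlyVanishing_of_not_and (h : ¬(HasRepeat y ∧ IsMixed x)) :
    UniformlyVanishing x y := by
  intro u hu v hv huv hne
  by_contra hiff
  have hne' : u ≠ v := by
    rintro rfl
    exact hiff Iff.rfl
  refine h ⟨⟨u, hu, v, hv, hne', huv, hne⟩, ?_⟩
  by_cases hux : ⟪u, x⟫ = 0
  · exact ⟨⟨u, hu, hux⟩, v, hv, fun hvx => hiff (iff_of_true hux hvx)⟩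
  · exact ⟨⟨v, hv, not_not.1 fun hvx => hiff (iff_of_false hux hvx)⟩, u, hu, hux⟩

theorem exists_not_singleOrbit_left (hy : HasRepeat y) (hx : IsMixed x) :
    ∃ w ∈ weyl n, ¬SingleOrbit x (w y) := by
  obtain ⟨u, hu, v, hv, huv, hpos, heq⟩ := hy.exists_pos
  obtain ⟨u', hu', v', hv', huv', hux, hvx⟩ := hx.exists_pos
  obtain ⟨w, hw, rfl, rfl, -⟩ := exists_map_eq_map_eq hu hv hu' hv' huv huv'
  refine ⟨w, hw, not_singleOrbit_of_inner_eq hu' hv' ?_ ?_ hux hvx⟩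
  · rwa [LinearIsometryEquiv.inner_map_map]
  · rwa [LinearIsometryEquiv.inner_map_map, LinearIsometryEquiv.inner_map_map]

theorem exists_not_singleOrbit_right (hx : HasRepeat x) (hy : IsMixed y) :
    ∃ w ∈ weyl n, ¬SingleOrbit x (w y) := by
  obtain ⟨u, hu, v, hv, huv, hpos, heq⟩ := hx.exists_pos
  obtain ⟨u', hu', v', hv', huv', huy, hvy⟩ := hy.exists_pos
  obtain ⟨w, hw, rfl, rfl, -⟩ := exists_map_eq_map_eq hu' hv' hu hv huv' huv
  refine ⟨w, hw, fun h => not_singleOrbit_of_inner_eq hu hv hpos heq ?_ ?_ h.symm⟩ <;>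
    rwa [LinearIsometryEquiv.inner_map_map]

theorem forall_singleOrbit_iff :
    (∀ w ∈ weyl n, SingleOrbit x (w y)) ↔
      ¬(HasRepeat x ∧ IsMixed y) ∧ ¬(HasRepeat y ∧ IsMixed x) := by
  constructor
  · refine fun h => ⟨fun hr => ?_, fun hr => ?_⟩
    · obtain ⟨w, hw, hns⟩ := exists_not_singleOrbit_right hr.1 hr.2
      exact hns (h w hw)
    · obtain ⟨w, hw, hns⟩ := exists_not_singleOrbit_left hr.1 hr.2
      exact hns (h w hw)
  · rintro ⟨hxy, hyx⟩ w hw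
    exact (uniformlyVanishing_of_not_and fun h => hyx ⟨h.1.of_map hw, h.2⟩).singleOrbit
      (uniformlyVanishing_of_not_and fun h => hxy ⟨h.1, h.2.of_map hw⟩)

end Criterion

/-! ### Classification -/

section Classification

variable {n : ℕ} {P Q : Set (Fin n)}

theorem inner_e_dominantVector (P : Set (Fin n)) (i : Fin n) :
    ⟪e i, dominantVector P⟫ = (Set.Ici i \ P).ncard := by
  classical
  have card_eq : (Set.Ici i \ P).ncard = (Finset.univ.filter fun k => k ∉ P ∧ i ≤ k).card := by
    rw [← Set.ncard_coe_finset]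
    congr 1
    ext k
    simp [and_comm]
  rw [card_eq, dominantVector, inner_sum, Finset.card_filter, Nat.cast_sum]
  refine Finset.sum_congr rfl fun k _ => ?_
  by_cases hk : k ∈ P <;> simp [hk, inner_e_coweight]

theorem inner_e_dominantVector_nonneg (P : Set (Fin n)) (i : Fin n) :
    0 ≤ ⟪e i, dominantVector P⟫ := by
  rw [inner_e_dominantVector]
  exact Nat.cast_nonneg _

theorem inner_e_dominantVector_eq_zero_iff {i : Fin n} :
    ⟪e i, dominantVector P⟫ = 0 ↔ Set.Ici i ⊆ P := by
  rw [inner_e_dominantVector, Nat.cast_eq_zero, Set.ncard_eq_zero, Set.sdiff_eq_empty]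

theorem inner_e_dominantVector_lt {i j : Fin n} (hij : i < j) (hi : i ∉ P) :
    ⟪e j, dominantVector P⟫ < ⟪e i, dominantVector P⟫ := by
  rw [inner_e_dominantVector, inner_e_dominantVector, Nat.cast_lt]
  refine Set.ncard_lt_ncard (Set.ssubset_iff_of_subset ?_ |>.2 ⟨i, ⟨Set.self_mem_Ici, hi⟩, ?_⟩)
  · exact Set.sdiff_subset_sdiff_left (Set.Ici_subset_Ici.2 hij.le)
  · exact fun h => hij.not_ge h.1

theorem exists_eq_e_of_inner_dominantVector_pos {u : Space n} (hu : u ∈ signedBasis n)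
    (h : 0 < ⟪u, dominantVector P⟫) : ∃ i, u = e i := by
  obtain ⟨i, rfl | rfl⟩ := hu
  · exact ⟨i, rfl⟩
  · rw [inner_neg_left, neg_pos] at h
    exact absurd h (inner_e_dominantVector_nonneg P i).not_gt

theorem hasRepeat_dominantVector_iff : HasRepeat (dominantVector P) ↔ ¬IsUpperSet P := by
  constructor
  · intro h hP
    obtain ⟨u, hu, v, hv, huv, hpos, heq⟩ := h.exists_pos
    obtain ⟨i, rfl⟩ := exists_eq_e_of_inner_dominantVector_pos hu hpos
    obtain ⟨j, rfl⟩ := exists_eq_e_of_inner_dominantVector_pos hv (heq ▸ hpos)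
    have hij : i ≠ j := by
      rintro rfl
      rw [inner_self_signedBasis hu] at huv
      exact one_ne_zero huv
    have notMem {k : Fin n} (hk : 0 < ⟪e k, dominantVector P⟫) : k ∉ P := fun hkP =>
      hk.ne' (inner_e_dominantVector_eq_zero_iff.2 (hP.Ici_subset hkP))
    rcases hij.lt_or_gt with hlt | hlt
    · exact (inner_e_dominantVector_lt hlt (notMem hpos)).ne' heq
    · exact (inner_e_dominantVector_lt hlt (notMem (heq ▸ hpos))).ne heq
  · intro hP
    obtain ⟨i, k, hik, hi, hk⟩ : ∃ i k, i ≤ k ∧ i ∈ P ∧ k ∉ P := by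
      simpa [IsUpperSet] using hP
    have hlt : (i : ℕ) < k := lt_of_le_of_ne hik fun h => hk (Fin.ext h ▸ hi)
    have hsucc : (i : ℕ) + 1 < n := lt_of_le_of_lt hlt k.2
    have hzero := inner_simpleRoot_dominantVector_of_mem hi
    rw [simpleRoot_of_lt hsucc, inner_sub_left, sub_eq_zero] at hzero
    refine ⟨e i, e_mem_signedBasis i, _, e_mem_signedBasis ⟨i + 1, hsucc⟩, ?_, hzero, ?_⟩
    · exact e_injective.ne (by simp [Fin.ext_iff])
    · exact fun h => hk (inner_e_dominantVector_eq_zero_iff.1 h hik)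

theorem isMixed_dominantVector_iff {m : Fin n} (hm : IsTop m) :
    IsMixed (dominantVector P) ↔ m ∈ P ∧ P ≠ Set.univ := by
  constructor
  · rintro ⟨⟨_, ⟨i, hu⟩, hi⟩, _, ⟨j, hv⟩, hj⟩
    have hi : ⟪e i, dominantVector P⟫ = 0 := by
      rcases hu with rfl | rfl
      · exact hi
      · rwa [inner_neg_left, neg_eq_zero] at hi
    refine ⟨inner_e_dominantVector_eq_zero_iff.1 hi (hm i), ?_⟩
    rintro rfl
    have hj₀ := inner_e_dominantVector_eq_zero_iff.2 (Set.subset_univ (Set.Ici j))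
    rcases hv with rfl | rfl
    · exact hj hj₀
    · rw [inner_neg_left, hj₀, neg_zero] at hj
      exact hj rfl
  · rintro ⟨hmP, hP⟩
    obtain ⟨k, hk⟩ := (Set.ne_univ_iff_exists_notMem P).1 hP
    refine ⟨⟨e m, e_mem_signedBasis m, ?_⟩, e k, e_mem_signedBasis k, fun h => ?_⟩
    · rwa [inner_e_dominantVector_eq_zero_iff, hm.isMax.Ici_eq, Set.singleton_subset_iff]
    · exact hk (inner_e_dominantVector_eq_zero_iff.1 h Set.self_mem_Ici)

theorem isUpperSet_conditions_iff {m : Fin n} (hm : IsTop m) :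
    ¬(¬IsUpperSet Q ∧ m ∈ P ∧ P ≠ Set.univ) ∧ ¬(¬IsUpperSet P ∧ m ∈ Q ∧ Q ≠ Set.univ) ↔
      (∃ p q, P = Set.Ici p ∧ Q = Set.Ici q) ∨ (m ∉ P ∧ m ∉ Q) ∨
        (P = Set.univ ∨ Q = Set.univ) ∨ (P = ∅ ∨ Q = ∅) := by
  have up (S : Set (Fin n)) : IsUpperSet S ↔ S = ∅ ∨ ∃ p, S = Set.Ici p := by
    refine ⟨IsUpperSet.eq_empty_or_Ici, ?_⟩
    rintro (rfl | ⟨p, rfl⟩)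
    exacts [isUpperSet_empty, isUpperSet_Ici p]
  have top_mem (p : Fin n) : m ∈ Set.Ici p := hm p
  have up_univ : Set.univ = (∅ : Set (Fin n)) ∨ ∃ p, Set.univ = Set.Ici p :=
    (up Set.univ).1 isUpperSet_univ
  rw [up, up]
  grind

end Classification

end TypeC

end

theorem mainTheorem8 (n : ℕ) (hn : 2 ≤ n) (P Q : Set (Fin n))
    (D : TypeC.DoubleMomentGraph Q P) :
    D.IsClosed ↔
      ((∃ p q : Fin n, P = Set.Ici p ∧ Q = Set.Ici q) ∨
        ((⟨n - 1, by omega⟩ : Fin n) ∉ P ∧ (⟨n - 1, by omega⟩ : Fin n) ∉ Q) ∨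
        (P = Set.univ ∨ Q = Set.univ) ∨
        (P = ∅ ∨ Q = ∅)) := by
  have isTop_last : IsTop (⟨n - 1, by omega⟩ : Fin n) := fun i =>
    Fin.le_def.2 (Nat.le_sub_one_of_lt i.2)
  rw [TypeC.DoubleMomentGraph.isClosed_iff_forall_singleOrbit, TypeC.forall_singleOrbit_iff,
    TypeC.hasRepeat_dominantVector_iff, TypeC.hasRepeat_dominantVector_iff,
    TypeC.isMixed_dominantVector_iff isTop_last, TypeC.isMixed_dominantVector_iff isTop_last]
  exact TypeC.isUpperSet_conditions_iff isTop_last
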